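/- Let $\lambda_l,\lambda_v\ge 0$, $p\in[0,1]$, $P_t>0$, $\alpha>2$, $d>0$, $\beta>0$ and $\sigma\in\mathbb R$. Consider the Cox bipolar network seen from the receiver of the typical link, which is placed at the origin $o$ of $\mathbb R^2$ (Palm setting): - $\Phi_l$ is a Poisson line process: each line is represented by $(r,\theta)\in[0,\infty)\times[0,2\pi)$, where $r(\cos\theta,\sin\theta)$ is the foot of the perpendicular from $o$ to the line, and the representing points form a Poisson point process with density $\lambda_l$ (i.e. line density $\mu_l=\pi\lambda_l$). In addition there is the typical line $L_0$ through $o$, with arbitrary orientation; $\Phi_{l_0}=\Phi_l\cup\{L_0\}$. - The nodes on each line of $\Phi_{l_0}$ form a 1D Poisson point process of density $\lambda_v$ with respect to arc length (on $L_0$ the transmitter of the typical link is not counted). Each node transmits with probability $p$ (slotted ALOHA), so that the set $\Psi_L$ of transmitting nodes on a line $L$ is a Poisson point process of density $p\lambda_v$. - The fading gains $h_0$ (typical link) and $h_{\rm w}$ (from the node at ${\rm w}$ to $o$) are exponential with mean $1$. The line process, the node processes on the different lines, the transmission decisions and all fading gains are mutually independent. Let $$I_0=\sum_{{\rm w}\in\Psi_{L_0}}P_th_{\rm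 w}\|{\rm w}\|^{-\alpha},\qquad I_1=\sum_{L\in\Phi_l}\sum_{{\rm w}\in\Psi_L}P_th_{\rm w}\|{\rm w}\|^{-\alpha},\qquad \mathrm{SINR}=\frac{P_th_0d^{-\alpha}}{I_0+I_1+\sigma^2}$$ (with $\mathrm{SINR}=\infty$ if $h_0>0$ and the denominator is $0$), and $\mathcal L_{I_k}(s)=\mathbb E[e^{-sI_k}]$. Then $I_0$ and $I_1$ are almost surely finite, for every $s>0$ $$\mathcal L_{I_0}(s)=\exp\Big[-2p\lambda_v\int_0^\infty\frac{dx}{1+(sP_t)^{-1}x^\alpha}\Big],$$ $$\mathcal L_{I_1}(s)=\exp\Big[-2\pi\lambda_l\int_0^\infty\Big(1-\exp\Big(-2p\lambda_v\int_0^\infty\frac{dx}{1+s^{-1}P_t^{-1}(y^2+x^2)^{\alpha/2}}\Big)\Big)dy\Big],$$ and the success probability of the typical link is $$\mathbb P(\mathrm{SINR}>\beta)=e^{-\beta\sigma^2d^\alpha/P_t}\,\mathcal L_{I_0}\Big(\frac{\beta d^\alpha}{P_t}\Big)\,\mathcal L_{I_1}\Big(\frac{\beta d^\alpha}{P_t}\Big),$$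 that is, $$\mathbb P(\mathrm{SINR}>\beta)=\exp\Big[-\frac{\beta\sigma^2d^\alpha}{P_t}-2p\lambda_v\int_0^\infty\frac{\beta d^\alpha x^{-\alpha}}{1+\beta d^\alpha x^{-\alpha}}\,dx-2\pi\lambda_l\int_0^\infty\Big(1-\exp\Big[-2p\lambda_v\int_0^\infty\frac{\beta d^\alpha(y^2+x^2)^{-\alpha/2}}{1+\beta d^\alpha(y^2+x^2)^{-\alpha/2}}\,dx\Big]\Big)dy\Big],$$ where all the integrals converge. -/

import Mathlib

open MeasureTheory ProbabilityTheory Set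

open scoped ENNReal

noncomputable section

namespace CoxBipolar

/-- A measurable enumeration of a random, finite or countably infinite, collection of points of
`X`: the points are `pt i ω` for `i < count ω`; the later values of `pt` are irrelevant. -/
structure PointProcess (Ω X : Type*) [MeasurableSpace Ω] [MeasurableSpace X] where
  count : Ω → ℕ∞
  pt : ℕ → Ω → X
  measurable_count : Measurable count
  measurable_pt : ∀ i, Measurable (pt i)

namespace PointProcess

variable {Ω X : Type*} [MeasurableSpace Ω] [MeasurableSpace X]

/-- The number of points in `B`. -/
def num (Φ : PointProcess Ω X) (B : Set X) (ω : Ω) : ℕ∞ :=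
  Set.encard {i : ℕ | (i : ℕ∞) < Φ.count ω ∧ Φ.pt i ω ∈ B}

/-- The σ-algebra generated by the enumerated process. -/
@[reducible]
def sigma (Φ : PointProcess Ω X) : MeasurableSpace Ω :=
  MeasurableSpace.comap Φ.count inferInstance ⊔
    ⨆ i, MeasurableSpace.comap (Φ.pt i) inferInstance

/-- `Φ` is a Poisson point process with intensity measure `ν`: the number of points in a set `B`
of finite intensity is Poisson with mean `ν B`, and the numbers of points in disjoint sets are
independent. -/
structure IsPoisson (Φ : PointProcess Ω X) (ν : Measure X) (μ : Measure Ω) : Prop where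
  law : ∀ B : Set X, MeasurableSet B → ν B ≠ ∞ →
    ∀ k : ℕ, μ {ω | Φ.num B ω = k} = poissonMeasure (ν B).toNNReal {k}
  indep : ∀ (n : ℕ) (B : Fin n → Set X), (∀ i, MeasurableSet (B i)) → (∀ i, ν (B i) ≠ ∞) →
    Pairwise (fun i j => Disjoint (B i) (B j)) → iIndepFun (fun i => Φ.num (B i)) μ

end PointProcess

/-- The point with signed arc-length coordinate `t` on the line whose foot of the perpendicular
from the origin is `r (cos θ, sin θ)`. The coordinate `t` is measured from that foot, in the
direction `(-sin θ, cos θ)`. -/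
def linePoint (r θ t : ℝ) : EuclideanSpace ℝ (Fin 2) :=
  !₂[r * Real.cos θ - t * Real.sin θ, r * Real.sin θ + t * Real.cos θ]

/-- The random objects that determine the SINR at the receiver of the typical link, which sits at
the origin. Lines are indexed by `Option ℕ`: `none` is the typical line through the origin,
`some j` is the `j`-th line of the line process. -/
structure Network (Ω : Type*) [MeasurableSpace Ω] where
  /-- The line process, as points `(r, θ)` of the representation space. -/
  lines : PointProcess Ω (ℝ × ℝ)
  /-- The orientation of the typical line. -/
  typicalAngle : Ω → ℝ
  /-- The arc-length coordinates of the nodes on each line. On the typical line these are the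
  nodes other than the transmitter of the typical link. -/
  nodes : Option ℕ → PointProcess Ω ℝ
  /-- Whether the `i`-th node of a line transmits in the current slot. -/
  active : Option ℕ → ℕ → Ω → Bool
  /-- The fading gain between the `i`-th node of a line and the typical receiver. -/
  fading : Option ℕ → ℕ → Ω → ℝ
  /-- The fading gain of the typical link. -/
  linkFading : Ω → ℝ

/-- Labels of the independent sources of randomness of the network. -/
inductive Source where
  | lines : Source
  | nodes (l : Option ℕ) : Source
  | active (l : Option ℕ) (i : ℕ) : Source
  | fading (l : Option ℕ) (i : ℕ) : Source
  | linkFading : Source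

namespace Network

variable {Ω : Type*} [MeasurableSpace Ω]

/-- The σ-algebra generated by one of the sources of randomness. -/
@[reducible]
def sigma (N : Network Ω) : Source → MeasurableSpace Ω
  | .lines => N.lines.sigma
  | .nodes l => (N.nodes l).sigma
  | .active l i => MeasurableSpace.comap (N.active l i) inferInstance
  | .fading l i => MeasurableSpace.comap (N.fading l i) inferInstance
  | .linkFading => MeasurableSpace.comap N.linkFading inferInstance

/-- The probabilistic model of the Cox bipolar network seen from the receiver of the typical link:
* the lines form a Poisson line process, i.e. their representations `(r, θ)` form a Poisson process
  with density `lamL` on `[0, ∞) × [0, 2π)`;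
* the nodes on every line, including the typical one, form a Poisson process of density `lamV`;
* every node transmits with probability `p` (slotted ALOHA);
* the fading gains are exponential with mean 1 (Rayleigh fading);
* all of these are independent.

No law is imposed on the orientation of the typical line: it does not influence the distances
to the origin. -/
structure IsCoxBipolar (N : Network Ω) (μ : Measure Ω) (lamL lamV p : ℝ) : Prop where
  lines_poisson : N.lines.IsPoisson
    (ENNReal.ofReal lamL • (volume : Measure (ℝ × ℝ)).restrict
      (Ici 0 ×ˢ Ico 0 (2 * Real.pi))) μ
  nodes_poisson : ∀ l, (N.nodes l).IsPoisson (ENNReal.ofReal lamV • (volume : Measure ℝ)) μ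
  measurable_active : ∀ l i, Measurable (N.active l i)
  active_law : ∀ l i, μ {ω | N.active l i ω = true} = ENNReal.ofReal p
  measurable_fading : ∀ l i, Measurable (N.fading l i)
  fading_law : ∀ l i, μ.map (N.fading l i) = expMeasure 1
  measurable_linkFading : Measurable N.linkFading
  linkFading_law : μ.map N.linkFading = expMeasure 1
  indep : iIndep N.sigma μ

/-- The representation `(r, θ)` of a line. -/
def lineParam (N : Network Ω) : Option ℕ → Ω → ℝ × ℝ
  | none, ω => (0, N.typicalAngle ω)
  | some j, ω => N.lines.pt j ω

/-- The position in the plane of the `i`-th node on line `l`. -/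
def position (N : Network Ω) (l : Option ℕ) (i : ℕ) (ω : Ω) : EuclideanSpace ℝ (Fin 2) :=
  linePoint (N.lineParam l ω).1 (N.lineParam l ω).2 ((N.nodes l).pt i ω)

open Classical in
/-- The power received at the origin from the transmitting nodes on line `l`, with values in
`[0, ∞]`. -/
def lineInterference (N : Network Ω) (Pt α : ℝ) (l : Option ℕ) (ω : Ω) : ℝ≥0∞ :=
  ∑' i : ℕ, if (i : ℕ∞) < (N.nodes l).count ω ∧ N.active l i ω = true then
    ENNReal.ofReal (Pt * N.fading l i ω) * ENNReal.ofReal ‖N.position l i ω‖ ^ (-α) else 0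

/-- The interference `I₀` from the typical line. -/
def typicalInterference (N : Network Ω) (Pt α : ℝ) (ω : Ω) : ℝ≥0∞ :=
  N.lineInterference Pt α none ω

open Classical in
/-- The interference `I₁` from all the other lines. -/
def otherInterference (N : Network Ω) (Pt α : ℝ) (ω : Ω) : ℝ≥0∞ :=
  ∑' j : ℕ, if (j : ℕ∞) < N.lines.count ω then N.lineInterference Pt α (some j) ω else 0

/-- The SINR at the receiver of the typical link of length `d`, with noise power `σ ^ 2`. It is
`∞` if there is neither noise nor interference. -/
def sinr (N : Network Ω) (Pt α d σ : ℝ) (ω : Ω) : ℝ≥0∞ :=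
  ENNReal.ofReal (Pt * N.linkFading ω * d ^ (-α)) /
    (N.typicalInterference Pt α ω + N.otherInterference Pt α ω + ENNReal.ofReal (σ ^ 2))

end Network

/-- The Laplace transform `E[exp (-s I)]` of the law of an almost surely finite random variable
`I ≥ 0`. -/
def laplace {Ω : Type*} [MeasurableSpace Ω] (μ : Measure Ω) (I : Ω → ℝ≥0∞) (s : ℝ) : ℝ :=
  ∫ ω, Real.exp (-(s * (I ω).toReal)) ∂μ

end CoxBipolar

end

/-!
All the sums over points are handled through the function `expNeg x = e⁻ˣ` on `[0, ∞]`, for which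
`e⁻^∞ = 0`. With it, Laplace transforms are Lebesgue integrals that make sense before any sum is
known to be finite.

The basic fact is the Laplace functional of a Poisson process `Φ` with intensity `ν`,
`E exp (-∑ g(x)) = exp (-∫ (1 - e^{-g}) dν)` (`PointProcess.IsPoisson.lintegral_expNeg_sum`). For a
simple function `g` it follows from the independence of the numbers of points in disjoint sets and
the generating function of the Poisson law, and it passes to monotone limits. If the points carry
independent marks, integrating out the marks first replaces `e^{-g}` by the mean factor `k(x)` that
a point at `x` contributes (`PointProcess.IsPoisson.lintegral_expNeg_markedSum`).

This is used twice. The nodes on a line at distance `r` from the origin are marked by their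
transmission decisions and fading gains, and a node with path loss `ℓ` contributes the factor
`1 - p + p / (1 + c Pt ℓ)`, which gives the Laplace transform `K(r)` of the interference from one
line (`Network.IsCoxBipolar.lintegral_expNeg_linePower`). The lines are in turn the points of a
Poisson process, marked by everything that happens on them, and a line at distance `r` contributes
the factor `K(r)` (`Network.IsCoxBipolar.lintegral_expNeg_otherInterference`).

The integrals converge because the integrands are dominated by `(1 + ‖z‖) ^ (-α)`, which is
integrable over the line and, as `α > 2`, over the plane. By dominated convergence the exponents
tend to zero as the argument of the Laplace transforms does, so the interference is almost surely
finite. Finally, `SINR > β` means that the fading gain of the link exceeds `β d ^ α / Pt` times the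
noise plus interference. As this gain is exponential and independent of the interference, and as the
two interferences are independent, the success probability is a product of Laplace transforms.
-/

namespace CoxBipolar

/-! ### The exponential function on `[0, ∞]` -/

/-- The function `x ↦ e⁻ˣ` on `[0, ∞]`, with `e⁻^∞ = 0`. -/
noncomputable def expNeg (x : ℝ≥0∞) : ℝ≥0∞ := EReal.exp (-(x : EReal))

@[simp] lemma expNeg_zero : expNeg 0 = 1 := by simp [expNeg]

@[simp] lemma expNeg_top : expNeg ∞ = 0 := by simp [expNeg]

lemma expNeg_add (x y : ℝ≥0∞) : expNeg (x + y) = expNeg x * expNeg y := by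
  rw [expNeg, EReal.coe_ennreal_add, EReal.neg_add (by simp) (by simp), sub_eq_add_neg,
    EReal.exp_add]
  rfl

lemma expNeg_ofReal {x : ℝ} (hx : 0 ≤ x) :
    expNeg (ENNReal.ofReal x) = ENNReal.ofReal (Real.exp (-x)) := by
  rw [expNeg, EReal.coe_ennreal_ofReal, max_eq_left hx, ← EReal.coe_neg, EReal.exp_coe]

lemma expNeg_eq_ofReal {x : ℝ≥0∞} (hx : x ≠ ∞) :
    expNeg x = ENNReal.ofReal (Real.exp (-x.toReal)) := by
  rw [← expNeg_ofReal ENNReal.toReal_nonneg, ENNReal.ofReal_toReal hx]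

lemma continuous_expNeg : Continuous expNeg := by
  unfold expNeg
  exact ENNReal.continuous_exp.comp (continuous_neg.comp continuous_coe_ennreal_ereal)

lemma measurable_expNeg : Measurable expNeg := continuous_expNeg.measurable

lemma antitone_expNeg : Antitone expNeg := fun x y h => by
  simpa [expNeg] using h

lemma expNeg_le_one (x : ℝ≥0∞) : expNeg x ≤ 1 := by
  simpa using antitone_expNeg (zero_le (a := x))

lemma expNeg_ne_top (x : ℝ≥0∞) : expNeg x ≠ ∞ :=
  ne_top_of_le_ne_top ENNReal.one_ne_top (expNeg_le_one x)

lemma expNeg_sum {ι : Type*} (s : Finset ι) (f : ι → ℝ≥0∞) :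
    expNeg (∑ i ∈ s, f i) = ∏ i ∈ s, expNeg (f i) := by
  classical
  induction s using Finset.induction_on with
  | empty => simp
  | insert a s ha ih => rw [Finset.sum_insert ha, Finset.prod_insert ha, expNeg_add, ih]

lemma expNeg_mul_natCast (c : ℝ≥0∞) (k : ℕ) : expNeg (c * k) = expNeg c ^ k := by
  induction k with
  | zero => simp
  | succ k ih => rw [Nat.cast_succ, mul_add, mul_one, expNeg_add, ih, pow_succ]

/-- A factor in `[0, 1]` is the `expNeg` of a measurable exponent, which turns products over the
points of a process into sums. -/
lemma exists_measurable_expNeg_eq {X : Type*} [MeasurableSpace X] {m : X → ℝ≥0∞}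
    (hm : Measurable m) (h1 : ∀ x, m x ≤ 1) :
    ∃ G : X → ℝ≥0∞, Measurable G ∧ ∀ x, expNeg (G x) = m x := by
  refine ⟨fun x => (ENNReal.log (m x)⁻¹).toENNReal,
    (hm.inv.ennreal_log).ereal_toENNReal, fun x => ?_⟩
  have h : 0 ≤ ENNReal.log (m x)⁻¹ := by
    rw [ENNReal.zero_le_log_iff]; simpa using h1 x
  rw [expNeg, EReal.coe_toENNReal h, EReal.exp_neg, ENNReal.exp_log, inv_inv]

lemma tendsto_expNeg_tsum (f : ℕ → ℝ≥0∞) :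
    Filter.Tendsto (fun n => ∏ i ∈ Finset.range n, expNeg (f i)) Filter.atTop
      (nhds (expNeg (∑' i, f i))) := by
  simp_rw [← expNeg_sum]
  exact (continuous_expNeg.tendsto _).comp ENNReal.summable.hasSum.tendsto_sum_nat

/-! ### The Laplace functional of a Poisson process -/

/-- The probability generating function of the Poisson distribution. -/
lemma tsum_poissonMeasure_mul_pow (r : NNReal) {z : ℝ≥0∞} (hz : z ≤ 1) :
    ∑' k : ℕ, z ^ k * poissonMeasure r {k} = expNeg (r * (1 - z)) := by
  lift z to NNReal using ne_top_of_le_ne_top ENNReal.one_ne_top hz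
  have hz' : z ≤ 1 := by exact_mod_cast hz
  have h1 : ∀ k : ℕ, (z : ℝ≥0∞) ^ k * poissonMeasure r {k} =
      ENNReal.ofReal (Real.exp (-r) * ((r * z : ℝ) ^ k / k.factorial)) := by
    intro k
    rw [poissonMeasure_singleton, ← ENNReal.ofReal_coe_nnreal, ← ENNReal.ofReal_pow (by positivity),
      ← ENNReal.ofReal_mul (by positivity)]
    congr 1
    rw [mul_pow]; ring
  have h2 : HasSum (fun k : ℕ => Real.exp (-r) * ((r * z : ℝ) ^ k / k.factorial))
      (Real.exp (-r) * Real.exp (r * z)) := by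
    rw [Real.exp_eq_exp_ℝ]
    exact (NormedSpace.expSeries_div_hasSum_exp (r * z : ℝ)).mul_left _
  simp_rw [h1]
  rw [← ENNReal.ofReal_tsum_of_nonneg (fun k => by positivity) h2.summable, h2.tsum_eq,
    ← Real.exp_add]
  have : (r : ℝ≥0∞) * (1 - z) = ENNReal.ofReal (r * (1 - z)) := by
    rw [ENNReal.ofReal_mul (by positivity), ENNReal.ofReal_sub _ (by positivity)]
    simp
  rw [this, expNeg_ofReal]
  · congr 2; ring
  · have : (z : ℝ) ≤ 1 := by exact_mod_cast hz'
    exact mul_nonneg (by positivity) (by linarith)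

namespace PointProcess

variable {Ω X : Type*} [MeasurableSpace Ω] [MeasurableSpace X]

open Classical in
/-- The sum of `g` over the points of the process. -/
noncomputable def sum (Φ : PointProcess Ω X) (g : X → ℝ≥0∞) (ω : Ω) : ℝ≥0∞ :=
  ∑' i : ℕ, if (i : ℕ∞) < Φ.count ω then g (Φ.pt i ω) else 0

open Classical in
lemma toENNReal_num (Φ : PointProcess Ω X) (B : Set X) (ω : Ω) :
    (Φ.num B ω : ℝ≥0∞) = Φ.sum (B.indicator 1) ω := by
  rw [num, ← ENNReal.tsum_set_one, tsum_subtype {i : ℕ | (i : ℕ∞) < Φ.count ω ∧ Φ.pt i ω ∈ B}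
    (fun _ => (1 : ℝ≥0∞)), sum]
  refine tsum_congr fun i => ?_
  by_cases h1 : (i : ℕ∞) < Φ.count ω <;> by_cases h2 : Φ.pt i ω ∈ B <;> simp [h1, h2, indicator]

lemma measurableSet_lt_count (Φ : PointProcess Ω X) (i : ℕ) :
    MeasurableSet {ω | (i : ℕ∞) < Φ.count ω} :=
  Φ.measurable_count (Set.to_countable (Ioi (i : ℕ∞))).measurableSet

lemma measurable_sum (Φ : PointProcess Ω X) {g : X → ℝ≥0∞} (hg : Measurable g) :
    Measurable (Φ.sum g) :=
  Measurable.tsum fun i => Measurable.ite (Φ.measurableSet_lt_count i)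
    (hg.comp (Φ.measurable_pt i)) measurable_const

lemma measurable_num (Φ : PointProcess Ω X) {B : Set X} (hB : MeasurableSet B) :
    Measurable (Φ.num B) := by
  have h : Measurable fun ω => (Φ.num B ω : ℝ≥0∞) := by
    simp_rw [toENNReal_num]
    exact Φ.measurable_sum (measurable_one.indicator hB)
  refine measurable_to_countable' fun k => ?_
  convert h (measurableSet_singleton (k : ℝ≥0∞)) using 1
  ext ω
  simp

namespace IsPoisson

variable {Φ : PointProcess Ω X} {ν : Measure X} {μ : Measure Ω}

lemma lintegral_expNeg_num [IsProbabilityMeasure μ] (hΦ : Φ.IsPoisson ν μ) {B : Set X}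
    (hB : MeasurableSet B) (hν : ν B ≠ ∞) (c : ℝ≥0∞) :
    ∫⁻ ω, expNeg (c * (Φ.num B ω : ℝ≥0∞)) ∂μ = expNeg ((1 - expNeg c) * ν B) := by
  have hm := Φ.measurable_num hB
  -- the number of points may take the value `∞`, but the finite values carry the total mass
  have hmap : μ.map (Φ.num B) = (poissonMeasure (ν B).toNNReal).map (Nat.cast : ℕ → ℕ∞) := by
    have := Measure.isProbabilityMeasure_map (μ := μ) hm.aemeasurable
    have hfin : ∀ k : ℕ, μ.map (Φ.num B) {(k : ℕ∞)} =
        (poissonMeasure (ν B).toNNReal).map (Nat.cast : ℕ → ℕ∞) {(k : ℕ∞)} := by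
      intro k
      rw [Measure.map_apply hm (measurableSet_singleton _),
        Measure.map_apply (by fun_prop) (measurableSet_singleton _)]
      have : (Nat.cast : ℕ → ℕ∞) ⁻¹' {(k : ℕ∞)} = {k} := by ext; simp
      rw [this, ← hΦ.law B hB hν k]
      rfl
    have hle : (poissonMeasure (ν B).toNNReal).map (Nat.cast : ℕ → ℕ∞) ≤ μ.map (Φ.num B) := by
      refine Measure.le_iff.2 fun s hs => ?_
      rw [Measure.map_apply (by fun_prop) hs,
        ← Measure.tsum_indicator_apply_singleton _ _ (by measurability)]
      rw [← Measure.tsum_indicator_apply_singleton (μ.map _) _ hs]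
      refine le_trans (le_of_eq (tsum_congr fun k => ?_))
        (ENNReal.tsum_comp_le_tsum_of_injective Nat.cast_injective _)
      by_cases hk : (k : ℕ∞) ∈ s
      · simp only [indicator, mem_preimage, hk, if_true, hfin]
        rw [Measure.map_apply (by fun_prop) (measurableSet_singleton _)]
        congr 1; ext; simp
      · simp [indicator, hk]
    have := Measure.isProbabilityMeasure_map (μ := poissonMeasure (ν B).toNNReal)
      (f := (Nat.cast : ℕ → ℕ∞)) (by fun_prop)
    exact (Measure.eq_of_le_of_measure_univ_eq hle (by simp)).symm
  have hF : Measurable fun k : ℕ∞ => expNeg (c * (k : ℝ≥0∞)) := measurable_of_countable _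
  calc ∫⁻ ω, expNeg (c * (Φ.num B ω : ℝ≥0∞)) ∂μ
      = ∫⁻ k, expNeg (c * (k : ℝ≥0∞)) ∂(μ.map (Φ.num B)) := (lintegral_map hF hm).symm
    _ = ∑' k : ℕ, expNeg c ^ k * poissonMeasure (ν B).toNNReal {k} := by
        rw [hmap, lintegral_map hF (by fun_prop), lintegral_countable']
        simp [expNeg_mul_natCast]
    _ = _ := by
        rw [tsum_poissonMeasure_mul_pow _ (expNeg_le_one c), ENNReal.coe_toNNReal hν, mul_comm]

lemma lintegral_expNeg_sum_num [IsProbabilityMeasure μ] (hΦ : Φ.IsPoisson ν μ) {n : ℕ}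
    {B : Fin n → Set X} (hB : ∀ i, MeasurableSet (B i)) (hν : ∀ i, ν (B i) ≠ ∞)
    (hd : Pairwise (fun i j => Disjoint (B i) (B j))) (c : Fin n → ℝ≥0∞) :
    ∫⁻ ω, expNeg (∑ i, c i * (Φ.num (B i) ω : ℝ≥0∞)) ∂μ =
      expNeg (∑ i, (1 - expNeg (c i)) * ν (B i)) := by
  simp_rw [expNeg_sum]
  have hF : ∀ i, Measurable fun k : ℕ∞ => expNeg (c i * (k : ℝ≥0∞)) :=
    fun i => measurable_of_countable _
  have hind : iIndepFun (fun i ω => expNeg (c i * (Φ.num (B i) ω : ℝ≥0∞))) μ :=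
    (hΦ.indep n B hB hν hd).comp (fun i k => expNeg (c i * (k : ℝ≥0∞))) hF
  rw [lintegral_prod_eq_prod_lintegral_of_indepFun Finset.univ _ hind
    (fun i => (hF i).comp (Φ.measurable_num (hB i)))]
  exact Finset.prod_congr rfl fun i _ => hΦ.lintegral_expNeg_num (hB i) (hν i) (c i)

lemma lintegral_expNeg_sum_simpleFunc [IsProbabilityMeasure μ] (hΦ : Φ.IsPoisson ν μ)
    (g : SimpleFunc X ℝ≥0∞) (hg : ∀ c ≠ 0, ν (g ⁻¹' {c}) ≠ ∞) :
    ∫⁻ ω, expNeg (Φ.sum g ω) ∂μ = expNeg (∫⁻ x, (1 - expNeg (g x)) ∂ν) := by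
  classical
  set s := g.range.filter (· ≠ 0) with hs
  let e := s.equivFin
  let c : Fin s.card → ℝ≥0∞ := fun i => (e.symm i : ℝ≥0∞)
  let B : Fin s.card → Set X := fun i => g ⁻¹' {c i}
  have hc0 : ∀ i, c i ≠ 0 := fun i => (Finset.mem_filter.1 (e.symm i).2).2
  have hB : ∀ i, MeasurableSet (B i) := fun i => g.measurableSet_fiber _
  have hcinj : Function.Injective c := Subtype.val_injective.comp e.symm.injective
  have hd : Pairwise (fun i j => Disjoint (B i) (B j)) := fun i j hij => by
    refine Set.disjoint_left.2 fun x hx hx' => hij (hcinj ?_)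
    rw [← show g x = c i from hx, ← show g x = c j from hx']
  -- the canonical representation, for every function of the value that vanishes at `0`
  have key : ∀ (F : ℝ≥0∞ → ℝ≥0∞), F 0 = 0 → ∀ x,
      F (g x) = ∑ i, F (c i) * (B i).indicator 1 x := by
    intro F hF x
    by_cases hx : g x = 0
    · rw [hx, hF, Finset.sum_eq_zero]
      intro i _
      rw [indicator_of_notMem, mul_zero]
      intro h
      exact hc0 i (by rw [← show g x = c i from h, hx])
    · have hmem : g x ∈ s := Finset.mem_filter.2 ⟨g.mem_range_self x, hx⟩
      have hci : c (e ⟨g x, hmem⟩) = g x := by simp [c]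
      rw [Finset.sum_eq_single (e ⟨g x, hmem⟩)]
      · rw [hci, indicator_of_mem (by simp [B, hci])]; simp
      · intro j _ hj
        rw [indicator_of_notMem, mul_zero]
        intro h
        exact hj (hcinj (by rw [hci]; exact (show g x = c j from h).symm))
      · simp
  have h1 : ∀ ω, Φ.sum g ω = ∑ i, c i * (Φ.num (B i) ω : ℝ≥0∞) := by
    intro ω
    simp_rw [toENNReal_num, PointProcess.sum, ← ENNReal.tsum_mul_left]
    rw [← Summable.tsum_finsetSum fun _ _ => ENNReal.summable]
    refine tsum_congr fun k => ?_
    split_ifs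
    · exact key id rfl _
    · simp
  have h2 : ∫⁻ x, (1 - expNeg (g x)) ∂ν = ∑ i, (1 - expNeg (c i)) * ν (B i) := by
    rw [lintegral_congr (key (fun y => 1 - expNeg y) (by simp)),
      lintegral_finsetSum _ fun i _ => (measurable_one.indicator (hB i)).const_mul _]
    refine Finset.sum_congr rfl fun i _ => ?_
    rw [lintegral_const_mul _ (measurable_one.indicator (hB i)), lintegral_indicator_one (hB i)]
  simp_rw [h1]
  rw [h2, hΦ.lintegral_expNeg_sum_num hB (fun i => hg _ (hc0 i)) hd]

/-- The Laplace functional of a Poisson point process. -/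
theorem lintegral_expNeg_sum [IsProbabilityMeasure μ] [SigmaFinite ν] (hΦ : Φ.IsPoisson ν μ)
    {g : X → ℝ≥0∞} (hg : Measurable g) :
    ∫⁻ ω, expNeg (Φ.sum g ω) ∂μ = expNeg (∫⁻ x, (1 - expNeg (g x)) ∂ν) := by
  let G : ℕ → SimpleFunc X ℝ≥0∞ := fun n => (SimpleFunc.eapprox g n).restrict (spanningSets ν n)
  have hG : ∀ n x, G n x = (spanningSets ν n).indicator (SimpleFunc.eapprox g n) x := fun n x => by
    simp [G, SimpleFunc.restrict_apply _ (measurableSet_spanningSets ν n)]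
  have hmono : ∀ x, Monotone fun n => G n x := fun x n m hnm => by
    simp only [hG]
    refine (indicator_le_indicator_of_subset (monotone_spanningSets ν hnm)
      (fun _ => zero_le) x).trans (indicator_le_indicator ?_)
    exact SimpleFunc.monotone_eapprox g hnm x
  have hlim : ∀ x, Filter.Tendsto (fun n => G n x) Filter.atTop (nhds (g x)) := fun x => by
    refine (SimpleFunc.tendsto_eapprox hg x).congr' ?_
    filter_upwards [Filter.eventually_ge_atTop (spanningSetsIndex ν x)] with n hn
    rw [hG, indicator_of_mem (mem_spanningSets_of_index_le ν x hn)]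
  have hfin : ∀ n, ∀ c ≠ 0, ν (G n ⁻¹' {c}) ≠ ∞ := fun n c hc => by
    refine ne_top_of_le_ne_top (measure_spanningSets_lt_top ν n).ne (measure_mono fun x hx => ?_)
    by_contra h
    have : G n x = c := hx
    rw [hG, indicator_of_notMem h] at this
    exact hc this.symm
  have hsum : ∀ ω, Filter.Tendsto (fun n => Φ.sum (G n) ω) Filter.atTop (nhds (Φ.sum g ω)) := by
    intro ω
    simp only [PointProcess.sum, ← lintegral_count]
    refine lintegral_tendsto_of_tendsto_of_monotone
      (fun n => (measurable_of_countable _).aemeasurable)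
      (.of_forall fun i n m hnm => ?_) (.of_forall fun i => ?_)
    · dsimp only
      split_ifs
      · exact hmono _ hnm
      · exact le_rfl
    · split_ifs
      · exact hlim _
      · exact tendsto_const_nhds
  have hL : Filter.Tendsto (fun n => ∫⁻ ω, expNeg (Φ.sum (G n) ω) ∂μ) Filter.atTop
      (nhds (∫⁻ ω, expNeg (Φ.sum g ω) ∂μ)) := by
    refine tendsto_lintegral_of_dominated_convergence (fun _ => 1)
      (fun n => measurable_expNeg.comp (Φ.measurable_sum (G n).measurable))
      (fun n => .of_forall fun ω => expNeg_le_one _) (by simp) (.of_forall fun ω => ?_)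
    exact (continuous_expNeg.tendsto _).comp (hsum ω)
  have hR : Filter.Tendsto (fun n => ∫⁻ x, (1 - expNeg (G n x)) ∂ν) Filter.atTop
      (nhds (∫⁻ x, (1 - expNeg (g x)) ∂ν)) := by
    refine lintegral_tendsto_of_tendsto_of_monotone
      (fun n => (measurable_const.sub (measurable_expNeg.comp (G n).measurable)).aemeasurable)
      (.of_forall fun x n m hnm => tsub_le_tsub_left (antitone_expNeg (hmono x hnm)) _)
      (.of_forall fun x => ?_)
    exact ENNReal.Tendsto.sub tendsto_const_nhds ((continuous_expNeg.tendsto _).comp (hlim x))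
      (.inl ENNReal.one_ne_top)
  refine tendsto_nhds_unique hL ?_
  simp_rw [hΦ.lintegral_expNeg_sum_simpleFunc _ (hfin _)]
  exact (continuous_expNeg.tendsto _).comp hR

end IsPoisson

end PointProcess

/-! ### Marked Poisson processes -/

section Independence

variable {Ω ι κ : Type*} {mΩ : MeasurableSpace Ω} {μ : Measure Ω}

/-- Independent σ-algebras remain independent when they are grouped into disjoint blocks. -/
lemma iIndep_iSup_of_pairwise_disjoint {m : ι → MeasurableSpace Ω} (h_le : ∀ i, m i ≤ mΩ)
    (h : iIndep m μ) {S : κ → Set ι} (hd : Pairwise (Function.onFun Disjoint S)) :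
    iIndep (fun j => ⨆ i ∈ S j, m i) μ := by
  classical
  have := h.isProbabilityMeasure
  rw [iIndep_iff]
  intro s
  induction s using Finset.induction_on with
  | empty => simp
  | insert a s ha ih =>
    intro f hf
    have hfs : ∀ j ∈ s, MeasurableSet[⨆ i ∈ S j, m i] (f j) :=
      fun j hj => hf j (Finset.mem_insert_of_mem hj)
    have hdis : Disjoint (S a) (⋃ j ∈ s, S j) := by
      simp only [disjoint_iUnion_right]
      exact fun j hj => hd (fun h => ha (h ▸ hj))
    have hInter : MeasurableSet[⨆ i ∈ ⋃ j ∈ s, S j, m i] (⋂ j ∈ s, f j) := by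
      refine @Finset.measurableSet_biInter _ _ (⨆ i ∈ ⋃ j ∈ s, S j, m i) _ s fun j hj => ?_
      refine (?_ : (⨆ i ∈ S j, m i) ≤ ⨆ i ∈ ⋃ j ∈ s, S j, m i) _ (hfs j hj)
      exact biSup_mono fun i hi => mem_biUnion (show j ∈ (s : Set κ) from hj) hi
    rw [Finset.set_biInter_insert, Finset.prod_insert ha, ← ih hfs]
    exact (Indep_iff _ _ _).1 (indep_iSup_of_disjoint h_le h hdis) _ _
      (hf a (Finset.mem_insert_self _ _)) hInter

lemma lintegral_indepFun_pair [IsProbabilityMeasure μ] {A B : Type*} [MeasurableSpace A]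
    [MeasurableSpace B] {a : Ω → A} {b : Ω → B} (ha : Measurable a) (hb : Measurable b)
    (hab : IndepFun a b μ) {F : A → B → ℝ≥0∞} (hF : Measurable (Function.uncurry F)) :
    ∫⁻ ω, F (a ω) (b ω) ∂μ = ∫⁻ ω, ∫⁻ ω', F (a ω) (b ω') ∂μ ∂μ := by
  have := Measure.isProbabilityMeasure_map (μ := μ) ha.aemeasurable
  have := Measure.isProbabilityMeasure_map (μ := μ) hb.aemeasurable
  calc ∫⁻ ω, F (a ω) (b ω) ∂μ
      = ∫⁻ z, Function.uncurry F z ∂(μ.map fun ω => (a ω, b ω)) :=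
        (lintegral_map hF (ha.prodMk hb)).symm
    _ = ∫⁻ x, ∫⁻ y, F x y ∂(μ.map b) ∂(μ.map a) := by
        rw [(indepFun_iff_map_prod_eq_prod_map_map ha.aemeasurable hb.aemeasurable).1 hab,
          lintegral_prod _ hF.aemeasurable]
        rfl
    _ = _ := by
        rw [lintegral_map (Measurable.lintegral_prod_right hF) ha]
        exact lintegral_congr fun ω => lintegral_map (hF.comp measurable_prodMk_left) hb

lemma comap_pi_eq_iSup {β : Type*} [MeasurableSpace β] (Y : ι → Ω → β) :
    MeasurableSpace.comap (fun ω i => Y i ω) MeasurableSpace.pi =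
      ⨆ i, MeasurableSpace.comap (Y i) inferInstance := by
  rw [MeasurableSpace.pi, MeasurableSpace.comap_iSup]
  simp_rw [MeasurableSpace.comap_comp]
  rfl

end Independence

namespace PointProcess

variable {Ω X : Type*} [MeasurableSpace Ω] [MeasurableSpace X]

/-- The number of points together with all the points, as one random element. -/
def data (Φ : PointProcess Ω X) (ω : Ω) : ℕ∞ × (ℕ → X) := (Φ.count ω, fun i => Φ.pt i ω)

lemma measurable_data (Φ : PointProcess Ω X) : Measurable Φ.data :=
  Φ.measurable_count.prodMk (measurable_pi_lambda _ Φ.measurable_pt)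

lemma comap_data (Φ : PointProcess Ω X) :
    MeasurableSpace.comap Φ.data inferInstance = Φ.sigma := by
  rw [PointProcess.sigma, ← comap_pi_eq_iSup, Prod.instMeasurableSpace, MeasurableSpace.prod,
    MeasurableSpace.comap_sup, MeasurableSpace.comap_comp, MeasurableSpace.comap_comp]
  rfl

open Classical in
/-- The sum of `g x y` over the points `x` with marks `y` of a marked point process. -/
noncomputable def markedSum {X M : Type*} (g : X → M → ℝ≥0∞) (a : ℕ∞ × (ℕ → X)) (y : ℕ → M) :
    ℝ≥0∞ :=
  ∑' i : ℕ, if (i : ℕ∞) < a.1 then g (a.2 i) (y i) else 0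

open Classical in
lemma measurable_markedTerm {M : Type*} [MeasurableSpace M] {g : X → M → ℝ≥0∞}
    (hg : Measurable (Function.uncurry g)) (i : ℕ) :
    Measurable fun z : (ℕ∞ × (ℕ → X)) × (ℕ → M) =>
      if (i : ℕ∞) < z.1.1 then g (z.1.2 i) (z.2 i) else 0 := by
  refine Measurable.ite ?_ ?_ measurable_const
  · exact (measurable_fst.comp measurable_fst) (Set.to_countable (Ioi (i : ℕ∞))).measurableSet
  · exact hg.comp (f := fun z : (ℕ∞ × (ℕ → X)) × (ℕ → M) => (z.1.2 i, z.2 i)) (by fun_prop)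

lemma mul_markedSum {X M : Type*} (c : ℝ≥0∞) (g : X → M → ℝ≥0∞) (a : ℕ∞ × (ℕ → X)) (y : ℕ → M) :
    c * markedSum g a y = markedSum (fun x y => c * g x y) a y := by
  rw [markedSum, ← ENNReal.tsum_mul_left]
  refine tsum_congr fun i => ?_
  split_ifs <;> simp

lemma measurable_markedSum {M : Type*} [MeasurableSpace M] {g : X → M → ℝ≥0∞}
    (hg : Measurable (Function.uncurry g)) :
    Measurable fun z : (ℕ∞ × (ℕ → X)) × (ℕ → M) => markedSum g z.1 z.2 :=
  Measurable.tsum fun i => measurable_markedTerm hg i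

/-- The Laplace transform of a sum over an independently marked Poisson process. The marks need
not be identically distributed: it is enough that the factor `k x` that a point at `x` contributes
does not depend on its index. -/
theorem IsPoisson.lintegral_expNeg_markedSum {Φ : PointProcess Ω X} {ν : Measure X} {μ : Measure Ω}
    [IsProbabilityMeasure μ] [SigmaFinite ν] (hΦ : Φ.IsPoisson ν μ)
    {M : Type*} [MeasurableSpace M] {Y : ℕ → Ω → M} (hY : ∀ i, Measurable (Y i))
    (hYi : iIndepFun Y μ)
    (hind : Indep Φ.sigma (⨆ i, MeasurableSpace.comap (Y i) inferInstance) μ)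
    {g : X → M → ℝ≥0∞} (hg : Measurable (Function.uncurry g)) {k : X → ℝ≥0∞}
    (hk : ∀ i x, ∫⁻ ω, expNeg (g x (Y i ω)) ∂μ = k x) :
    ∫⁻ ω, expNeg (markedSum g (Φ.data ω) (fun i => Y i ω)) ∂μ =
      expNeg (∫⁻ x, (1 - k x) ∂ν) := by
  classical
  have hkm : Measurable k := by
    rw [funext fun x => (hk 0 x).symm]
    exact Measurable.lintegral_prod_right (f := fun x ω => expNeg (g x (Y 0 ω)))
      (measurable_expNeg.comp (hg.comp (f := fun z : X × Ω => (z.1, Y 0 z.2))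
        (measurable_fst.prodMk ((hY 0).comp measurable_snd))))
  have hk1 : ∀ x, k x ≤ 1 := fun x => by
    rw [← hk 0 x]
    exact (lintegral_mono fun ω => expNeg_le_one _).trans (by simp)
  obtain ⟨G, hGm, hG⟩ := exists_measurable_expNeg_eq hkm hk1
  -- integrating out the first `n` marks
  have hfin : ∀ n : ℕ,
      ∫⁻ ω, ∏ i ∈ Finset.range n,
        expNeg (if (i : ℕ∞) < Φ.count ω then g (Φ.pt i ω) (Y i ω) else 0) ∂μ =
      ∫⁻ ω, ∏ i ∈ Finset.range n,
        expNeg (if (i : ℕ∞) < Φ.count ω then G (Φ.pt i ω) else 0) ∂μ := by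
    intro n
    have hpair := lintegral_indepFun_pair (μ := μ) (a := Φ.data) (b := fun ω i => Y i ω)
      (F := fun (a : ℕ∞ × (ℕ → X)) (y : ℕ → M) => ∏ i ∈ Finset.range n,
        expNeg (if (i : ℕ∞) < a.1 then g (a.2 i) (y i) else 0))
      Φ.measurable_data (measurable_pi_lambda _ hY)
      (by rw [IndepFun_iff_Indep, comap_data]
          exact (comap_pi_eq_iSup Y) ▸ hind)
      (Finset.measurable_fun_prod _ fun i _ => measurable_expNeg.comp (measurable_markedTerm hg i))
    refine hpair.trans (lintegral_congr fun ω => ?_)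
    have hm : ∀ i : ℕ, Measurable fun y : M =>
        expNeg (if (i : ℕ∞) < Φ.count ω then g (Φ.pt i ω) y else 0) := fun i => by
      split_ifs
      · exact measurable_expNeg.comp (hg.comp measurable_prodMk_left)
      · exact measurable_const
    refine (lintegral_prod_eq_prod_lintegral_of_indepFun _ _ (hYi.comp _ hm)
      fun i => (hm i).comp (hY i)).trans ?_
    refine Finset.prod_congr rfl fun i _ => ?_
    simp only [Function.comp_def]
    split_ifs
    · rw [hk, hG]
    · simp
  have hmeasY : ∀ i : ℕ, Measurable fun ω =>
      expNeg (if (i : ℕ∞) < Φ.count ω then g (Φ.pt i ω) (Y i ω) else 0) := fun i =>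
    measurable_expNeg.comp (Measurable.ite (Φ.measurableSet_lt_count i)
      (hg.comp ((Φ.measurable_pt i).prodMk (hY i))) measurable_const)
  have hmeasG : ∀ i : ℕ, Measurable fun ω =>
      expNeg (if (i : ℕ∞) < Φ.count ω then G (Φ.pt i ω) else 0) := fun i =>
    measurable_expNeg.comp (Measurable.ite (Φ.measurableSet_lt_count i)
      (hGm.comp (Φ.measurable_pt i)) measurable_const)
  have hlim : ∀ f : ℕ → Ω → ℝ≥0∞, (∀ i, Measurable fun ω => expNeg (f i ω)) →
      Filter.Tendsto (fun n => ∫⁻ ω, ∏ i ∈ Finset.range n, expNeg (f i ω) ∂μ) Filter.atTop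
        (nhds (∫⁻ ω, expNeg (∑' i, f i ω) ∂μ)) := fun f hf =>
    tendsto_lintegral_of_dominated_convergence (fun _ => 1)
      (fun n => Finset.measurable_fun_prod _ fun i _ => hf i)
      (fun n => .of_forall fun ω => Finset.prod_le_one' fun i _ => expNeg_le_one _) (by simp)
      (.of_forall fun ω => tendsto_expNeg_tsum _)
  have h1 := hlim _ hmeasY
  have h2 := hlim _ hmeasG
  simp_rw [hfin] at h1
  have h3 := tendsto_nhds_unique h1 h2
  have h4 := hΦ.lintegral_expNeg_sum hGm
  simp_rw [hG] at h4
  rw [← h4]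
  exact h3

end PointProcess

/-! ### Exponential fading -/

section Fading

variable {Ω : Type*} [MeasurableSpace Ω] {μ : Measure Ω}

lemma expMeasure_Iic_zero : expMeasure 1 (Iic 0) = 0 := by
  have := isProbabilityMeasure_expMeasure one_pos
  have h := cdf_expMeasure_eq one_pos 0
  rw [cdf_eq_real] at h
  simpa [measureReal_eq_zero_iff] using h

lemma expMeasure_Ioi {x : ℝ} (hx : 0 ≤ x) :
    expMeasure 1 (Ioi x) = ENNReal.ofReal (Real.exp (-x)) := by
  have := isProbabilityMeasure_expMeasure one_pos
  have h := cdf_expMeasure_eq one_pos x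
  rw [cdf_eq_real, if_pos hx] at h
  rw [← compl_Iic, ← ofReal_measureReal, probReal_compl_eq_one_sub measurableSet_Iic, h]
  congr 1
  ring_nf

lemma ae_pos_of_map_eq_expMeasure {H : Ω → ℝ} (hm : Measurable H)
    (hH : μ.map H = expMeasure 1) : ∀ᵐ ω ∂μ, 0 < H ω := by
  rw [ae_iff]
  have := expMeasure_Iic_zero
  rw [← hH, Measure.map_apply hm measurableSet_Iic] at this
  simpa [preimage] using this

/-- The tail of the standard exponential distribution. -/
lemma measure_lt_ofReal_of_map_eq_expMeasure {H : Ω → ℝ} (hm : Measurable H)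
    (hH : μ.map H = expMeasure 1) (x : ℝ≥0∞) :
    μ {ω | x < ENNReal.ofReal (H ω)} = expNeg x := by
  induction x using ENNReal.recTopCoe with
  | top => simp
  | coe x =>
    have h : {ω | (x : ℝ≥0∞) < ENNReal.ofReal (H ω)} = H ⁻¹' Ioi (x : ℝ) := by
      ext ω
      simp [ENNReal.lt_ofReal_iff_toReal_lt]
    rw [h, ← Measure.map_apply hm measurableSet_Ioi, hH, expMeasure_Ioi x.coe_nonneg,
      ← expNeg_ofReal x.coe_nonneg, ENNReal.ofReal_coe_nnreal]

/-- The Laplace transform of the standard exponential distribution. -/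
lemma lintegral_expNeg_mul_of_map_eq_expMeasure {H : Ω → ℝ} (hm : Measurable H)
    (hH : μ.map H = expMeasure 1) (c : ℝ≥0∞) :
    ∫⁻ ω, expNeg (c * ENNReal.ofReal (H ω)) ∂μ = (1 + c)⁻¹ := by
  induction c using ENNReal.recTopCoe with
  | top =>
    rw [lintegral_congr_ae (g := fun _ => 0)]
    · simp
    · filter_upwards [ae_pos_of_map_eq_expMeasure hm hH] with ω hω
      rw [ENNReal.top_mul (by simpa using hω), expNeg_top]
  | coe c =>
    have hF : Measurable fun x : ℝ => expNeg (c * ENNReal.ofReal x) :=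
      measurable_expNeg.comp (by fun_prop)
    rw [← lintegral_map hF hm, hH, expMeasure, gammaMeasure,
      lintegral_withDensity_eq_lintegral_mul (f := gammaPDF 1 1) _
        (measurable_gammaPDFReal 1 1).ennreal_ofReal hF]
    have h1 : ∀ x : ℝ, (gammaPDF 1 1 * fun x : ℝ => expNeg (c * ENNReal.ofReal x)) x =
        (Ici 0).indicator (fun x => ENNReal.ofReal (Real.exp (-(1 + c) * x))) x := by
      intro x
      by_cases hx : 0 ≤ x
      · have : (c : ℝ≥0∞) * ENNReal.ofReal x = ENNReal.ofReal (c * x) := by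
          rw [ENNReal.ofReal_mul c.coe_nonneg, ENNReal.ofReal_coe_nnreal]
        rw [Pi.mul_apply, indicator_of_mem (mem_Ici.2 hx), this, expNeg_ofReal (by positivity),
          gammaPDF_of_nonneg hx, ← ENNReal.ofReal_mul (by simp; positivity)]
        simp only [Real.one_rpow, Real.Gamma_one, sub_self, Real.rpow_zero]
        rw [div_one, one_mul, one_mul, ← Real.exp_add]
        ring_nf
      · rw [Pi.mul_apply, indicator_of_notMem (by simpa using hx),
          gammaPDF_of_neg (not_le.1 hx), zero_mul]
    have hc : -(1 + (c : ℝ)) < 0 := by have := c.coe_nonneg; linarith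
    rw [lintegral_congr h1, lintegral_indicator measurableSet_Ici,
      setLIntegral_congr Ioi_ae_eq_Ici.symm,
      ← ofReal_integral_eq_lintegral_ofReal (integrableOn_exp_mul_Ioi hc 0)
        (.of_forall fun x => (Real.exp_pos _).le), integral_exp_mul_Ioi hc]
    rw [mul_zero, Real.exp_zero, div_neg, neg_div, neg_neg, one_div, ENNReal.ofReal_inv_of_pos
      (by positivity), ENNReal.ofReal_add (by positivity) (by positivity)]
    simp

end Fading

/-! ### The interference from one line -/

lemma norm_linePoint (r θ t : ℝ) : ‖linePoint r θ t‖ = √(r ^ 2 + t ^ 2) := by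
  rw [EuclideanSpace.norm_eq]
  simp only [linePoint, Real.norm_eq_abs, sq_abs, Fin.sum_univ_two, PiLp.toLp_apply,
    Matrix.cons_val_zero, Matrix.cons_val_one]
  congr 1
  linear_combination (r ^ 2 + t ^ 2) * Real.sin_sq_add_cos_sq θ

/-- The path loss between the origin and the point with coordinate `t` on a line at distance `r`
from the origin. It is `∞` if that point is the origin. -/
noncomputable def pathLoss (α r t : ℝ) : ℝ≥0∞ := ENNReal.ofReal √(r ^ 2 + t ^ 2) ^ (-α)

/-- The power received at the origin from a node with coordinate `t` on a line at distance `r`.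
The mark of the node records whether it transmits, and its fading gain. -/
noncomputable def nodePower (Pt α r t : ℝ) (y : Bool × ℝ) : ℝ≥0∞ :=
  if y.1 = true then ENNReal.ofReal (Pt * y.2) * pathLoss α r t else 0

lemma measurable_pathLoss (α : ℝ) : Measurable fun z : ℝ × ℝ => pathLoss α z.1 z.2 := by
  unfold pathLoss
  fun_prop

lemma measurable_nodePower (Pt α : ℝ) :
    Measurable fun z : ℝ × ℝ × (Bool × ℝ) => nodePower Pt α z.1 z.2.1 z.2.2 := by
  unfold nodePower
  refine Measurable.ite ?_ (Measurable.mul (by fun_prop) ?_) measurable_const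
  · exact (show Measurable fun z : ℝ × ℝ × (Bool × ℝ) => z.2.2.1 by fun_prop)
      (measurableSet_singleton true)
  · exact (measurable_pathLoss α).comp (f := fun z : ℝ × ℝ × (Bool × ℝ) => (z.1, z.2.1))
      (by fun_prop)

/-- The exponent of the Laplace transform, at `c`, of the interference from a line at distance `r`
from the origin. -/
noncomputable def lineExponent (lamV p Pt α : ℝ) (c : ℝ≥0∞) (r : ℝ) : ℝ≥0∞ :=
  ENNReal.ofReal lamV *
    ∫⁻ t : ℝ, ENNReal.ofReal p * (1 - (1 + c * ENNReal.ofReal Pt * pathLoss α r t)⁻¹)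

lemma measurable_lineExponent (lamV p Pt α : ℝ) (c : ℝ≥0∞) :
    Measurable (lineExponent lamV p Pt α c) := by
  refine Measurable.const_mul (Measurable.lintegral_prod_right
    (f := fun r t => ENNReal.ofReal p * (1 - (1 + c * ENNReal.ofReal Pt * pathLoss α r t)⁻¹)) ?_) _
  exact (measurable_const.sub (((measurable_pathLoss α).const_mul _).const_add _).inv).const_mul _

/-- The factor that a node contributes on average over its mark: the node is silent with probability
`1 - p`, and otherwise its fading gain is exponential. -/
lemma lintegral_expNeg_mark {Ω : Type*} [MeasurableSpace Ω] {μ : Measure Ω}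
    [IsProbabilityMeasure μ] {A : Ω → Bool} {H : Ω → ℝ} {p Pt : ℝ} (hA : Measurable A)
    (hH : Measurable H) (hAH : IndepFun A H μ) (hAp : μ {ω | A ω = true} = ENNReal.ofReal p)
    (hHe : μ.map H = expMeasure 1) (hPt : 0 ≤ Pt) (α : ℝ) (c : ℝ≥0∞) (r t : ℝ) :
    ∫⁻ ω, expNeg (c * nodePower Pt α r t (A ω, H ω)) ∂μ =
      ENNReal.ofReal p * (1 + c * ENNReal.ofReal Pt * pathLoss α r t)⁻¹ +
        (1 - ENNReal.ofReal p) := by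
  have hF : Measurable (Function.uncurry fun (b : Bool) (h : ℝ) =>
      expNeg (c * nodePower Pt α r t (b, h))) :=
    measurable_expNeg.comp (((measurable_nodePower Pt α).comp
      (f := fun z : Bool × ℝ => (r, t, z)) (by fun_prop)).const_mul c)
  rw [lintegral_indepFun_pair hA hH hAH hF]
  let G : Bool → ℝ≥0∞ := fun b => ∫⁻ ω', expNeg (c * nodePower Pt α r t (b, H ω')) ∂μ
  have hGt : G true = (1 + c * ENNReal.ofReal Pt * pathLoss α r t)⁻¹ := by
    rw [← lintegral_expNeg_mul_of_map_eq_expMeasure hH hHe]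
    refine lintegral_congr fun ω => ?_
    rw [nodePower, if_pos rfl, ENNReal.ofReal_mul hPt]
    congr 1
    ring
  have hGf : G false = 1 := by simp [G, nodePower]
  have hft : μ {ω | A ω = false} = 1 - ENNReal.ofReal p := by
    have : {ω | A ω = false} = {ω | A ω = true}ᶜ := by ext; simp
    have hs : MeasurableSet {ω | A ω = true} := hA (measurableSet_singleton true)
    rw [this, prob_compl_eq_one_sub hs, hAp]
  change ∫⁻ ω, G (A ω) ∂μ = _
  rw [← lintegral_map (measurable_of_countable G) hA, lintegral_fintype, Fintype.sum_bool, hGt, hGf,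
    Measure.map_apply hA (measurableSet_singleton _),
    Measure.map_apply hA (measurableSet_singleton _), one_mul]
  change _ * μ {ω | A ω = true} + μ {ω | A ω = false} = _
  rw [hAp, hft, mul_comm]

/-! ### The interference as a function of independent random elements -/

namespace Network

variable {Ω : Type*} [MeasurableSpace Ω] (N : Network Ω)

/-- The transmission decision and the fading gain of a node. -/
def mark (l : Option ℕ) (i : ℕ) (ω : Ω) : Bool × ℝ := (N.active l i ω, N.fading l i ω)

/-- All the randomness on one line: the nodes and their marks. -/
def lineData (l : Option ℕ) (ω : Ω) : (ℕ∞ × (ℕ → ℝ)) × (ℕ → Bool × ℝ) :=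
  ((N.nodes l).data ω, fun i => N.mark l i ω)

/-- All the randomness outside the typical line and the typical link. -/
def otherData (ω : Ω) :
    (ℕ∞ × (ℕ → ℝ × ℝ)) × (ℕ → (ℕ∞ × (ℕ → ℝ)) × (ℕ → Bool × ℝ)) :=
  (N.lines.data ω, fun j => N.lineData (some j) ω)

/-- The sources of randomness on one line. -/
def lineSources (l : Option ℕ) : Set Source :=
  {Source.nodes l} ∪ range (Source.active l) ∪ range (Source.fading l)

/-- The interference from a line at distance `r`, as a function of the randomness on that line. -/
noncomputable def linePower (Pt α r : ℝ) (D : (ℕ∞ × (ℕ → ℝ)) × (ℕ → Bool × ℝ)) : ℝ≥0∞ :=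
  PointProcess.markedSum (nodePower Pt α r) D.1 D.2

open Classical in
lemma measurable_linePower (Pt α : ℝ) :
    Measurable fun z : ℝ × ((ℕ∞ × (ℕ → ℝ)) × (ℕ → Bool × ℝ)) => linePower Pt α z.1 z.2 := by
  unfold linePower PointProcess.markedSum
  refine Measurable.tsum fun i => Measurable.ite ?_ ?_ measurable_const
  · exact (show Measurable fun z : ℝ × ((ℕ∞ × (ℕ → ℝ)) × (ℕ → Bool × ℝ)) => z.2.1.1 by fun_prop)
      (Set.to_countable (Ioi (i : ℕ∞))).measurableSet
  · exact (measurable_nodePower Pt α).comp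
      (f := fun z : ℝ × ((ℕ∞ × (ℕ → ℝ)) × (ℕ → Bool × ℝ)) => (z.1, z.2.1.2 i, z.2.2 i))
      (by fun_prop)

lemma measurable_linePower_right (Pt α r : ℝ) : Measurable (linePower Pt α r) :=
  (measurable_linePower Pt α).comp
    (f := fun D : (ℕ∞ × (ℕ → ℝ)) × (ℕ → Bool × ℝ) => (r, D)) (by fun_prop)

/-- The interference from the lines of the line process, as a function of the randomness outside
the typical line. -/
noncomputable def linesPower (Pt α : ℝ)
    (E : (ℕ∞ × (ℕ → ℝ × ℝ)) × (ℕ → (ℕ∞ × (ℕ → ℝ)) × (ℕ → Bool × ℝ))) : ℝ≥0∞ :=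
  PointProcess.markedSum (fun (z : ℝ × ℝ) D => linePower Pt α z.1 D) E.1 E.2

lemma measurable_linesPower (Pt α : ℝ) : Measurable (linesPower Pt α) :=
  PointProcess.measurable_markedSum ((measurable_linePower Pt α).comp
    (f := fun z : (ℝ × ℝ) × ((ℕ∞ × (ℕ → ℝ)) × (ℕ → Bool × ℝ)) => (z.1.1, z.2)) (by fun_prop))

lemma lineInterference_eq (Pt α : ℝ) (l : Option ℕ) (ω : Ω) :
    N.lineInterference Pt α l ω = linePower Pt α (N.lineParam l ω).1 (N.lineData l ω) := by
  refine tsum_congr fun i => ?_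
  by_cases h1 : (i : ℕ∞) < (N.nodes l).count ω <;> by_cases h2 : N.active l i ω = true <;>
    simp [lineData, PointProcess.data, nodePower, pathLoss, mark, position, norm_linePoint, h1, h2]

lemma typicalInterference_eq (Pt α : ℝ) (ω : Ω) :
    N.typicalInterference Pt α ω = linePower Pt α 0 (N.lineData none ω) :=
  N.lineInterference_eq Pt α none ω

lemma otherInterference_eq (Pt α : ℝ) (ω : Ω) :
    N.otherInterference Pt α ω = linesPower Pt α (N.otherData ω) := by
  refine tsum_congr fun j => ?_
  simp only [lineInterference_eq]
  rfl

namespace IsCoxBipolar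

variable {N} {μ : Measure Ω} {lamL lamV p : ℝ}

lemma measurable_mark (hN : N.IsCoxBipolar μ lamL lamV p) (l : Option ℕ) (i : ℕ) :
    Measurable (N.mark l i) :=
  (hN.measurable_active l i).prodMk (hN.measurable_fading l i)

lemma measurable_lineData (hN : N.IsCoxBipolar μ lamL lamV p) (l : Option ℕ) :
    Measurable (N.lineData l) :=
  (N.nodes l).measurable_data.prodMk (measurable_pi_lambda _ (hN.measurable_mark l))

lemma measurable_otherData (hN : N.IsCoxBipolar μ lamL lamV p) : Measurable N.otherData :=
  N.lines.measurable_data.prodMk (measurable_pi_lambda _ fun j => hN.measurable_lineData (some j))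

lemma sigma_le (hN : N.IsCoxBipolar μ lamL lamV p) (x : Source) :
    N.sigma x ≤ ‹MeasurableSpace Ω› := by
  cases x with
  | lines => rw [Network.sigma, ← PointProcess.comap_data]; exact N.lines.measurable_data.comap_le
  | nodes l =>
    rw [Network.sigma, ← PointProcess.comap_data]; exact (N.nodes l).measurable_data.comap_le
  | active l i => exact (hN.measurable_active l i).comap_le
  | fading l i => exact (hN.measurable_fading l i).comap_le
  | linkFading => exact hN.measurable_linkFading.comap_le

end IsCoxBipolar

lemma comap_mark (l : Option ℕ) (i : ℕ) : MeasurableSpace.comap (N.mark l i) inferInstance =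
    N.sigma (.active l i) ⊔ N.sigma (.fading l i) := by
  rw [Prod.instMeasurableSpace, MeasurableSpace.prod, MeasurableSpace.comap_sup,
    MeasurableSpace.comap_comp, MeasurableSpace.comap_comp]
  rfl

lemma comap_mark_le (l : Option ℕ) (i : ℕ) {S : Set Source} (h1 : .active l i ∈ S)
    (h2 : .fading l i ∈ S) :
    MeasurableSpace.comap (N.mark l i) inferInstance ≤ ⨆ x ∈ S, N.sigma x := by
  rw [comap_mark]
  exact sup_le (le_iSup₂_of_le _ h1 le_rfl) (le_iSup₂_of_le _ h2 le_rfl)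

lemma comap_lineData_le (l : Option ℕ) {S : Set Source} (hS : lineSources l ⊆ S) :
    MeasurableSpace.comap (N.lineData l) inferInstance ≤ ⨆ x ∈ S, N.sigma x := by
  rw [Prod.instMeasurableSpace, MeasurableSpace.prod, MeasurableSpace.comap_sup,
    MeasurableSpace.comap_comp, MeasurableSpace.comap_comp]
  refine sup_le ?_ ?_
  · refine le_trans (le_of_eq ?_) (le_iSup₂_of_le (.nodes l) (hS (by simp [lineSources])) le_rfl)
    exact PointProcess.comap_data _
  · refine le_trans (le_of_eq (comap_pi_eq_iSup (N.mark l))) (iSup_le fun i => ?_)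
    exact N.comap_mark_le l i (hS (by simp [lineSources])) (hS (by simp [lineSources]))

lemma comap_otherData_le {S : Set Source} (hS : .lines ∈ S)
    (hS' : ∀ j, lineSources (some j) ⊆ S) :
    MeasurableSpace.comap N.otherData inferInstance ≤ ⨆ x ∈ S, N.sigma x := by
  rw [Prod.instMeasurableSpace, MeasurableSpace.prod, MeasurableSpace.comap_sup,
    MeasurableSpace.comap_comp, MeasurableSpace.comap_comp]
  refine sup_le ?_ ?_
  · refine le_trans (le_of_eq ?_) (le_iSup₂_of_le .lines hS le_rfl)
    exact PointProcess.comap_data _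
  · refine le_trans (le_of_eq (comap_pi_eq_iSup fun j => N.lineData (some j)))
      (iSup_le fun j => ?_)
    exact N.comap_lineData_le _ (hS' j)

lemma disjoint_lineSources {l l' : Option ℕ} (h : l ≠ l') :
    Disjoint (lineSources l) (lineSources l') := by
  rw [Set.disjoint_left]
  rintro x ((rfl | ⟨i, rfl⟩) | ⟨i, rfl⟩) <;> simp [lineSources, h, h.symm]

namespace IsCoxBipolar

variable {N} {μ : Measure Ω} {lamL lamV p : ℝ}

lemma indep_of_disjoint (hN : N.IsCoxBipolar μ lamL lamV p) {S T : Set Source}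
    (h : Disjoint S T) : Indep (⨆ x ∈ S, N.sigma x) (⨆ x ∈ T, N.sigma x) μ :=
  indep_iSup_of_disjoint hN.sigma_le hN.indep h

lemma iIndepFun_mark (hN : N.IsCoxBipolar μ lamL lamV p) (l : Option ℕ) :
    iIndepFun (N.mark l) μ := by
  have h : Pairwise (Function.onFun Disjoint
      fun i : ℕ => ({.active l i, .fading l i} : Set Source)) := by
    intro i j hij
    simp [Function.onFun, hij.symm]
  exact iIndep_of_iIndep_of_le (iIndep_iSup_of_pairwise_disjoint hN.sigma_le hN.indep h)
    fun i => N.comap_mark_le l i (by simp) (by simp)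

lemma iIndepFun_lineData (hN : N.IsCoxBipolar μ lamL lamV p) :
    iIndepFun (fun j : ℕ => N.lineData (some j)) μ :=
  iIndep_of_iIndep_of_le (iIndep_iSup_of_pairwise_disjoint hN.sigma_le hN.indep
    (S := fun j : ℕ => lineSources (some j))
    fun i j hij => disjoint_lineSources (by simpa using hij))
    fun j => N.comap_lineData_le _ subset_rfl

/-! ### The Laplace transforms of the interference -/

variable [IsProbabilityMeasure μ]

/-- The Laplace transform of the interference from a line at distance `r` from the origin. -/
lemma lintegral_expNeg_linePower (hN : N.IsCoxBipolar μ lamL lamV p)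
    (hp1 : p ≤ 1) {Pt : ℝ} (hPt : 0 ≤ Pt) (α r : ℝ) (c : ℝ≥0∞) (l : Option ℕ) :
    ∫⁻ ω, expNeg (c * linePower Pt α r (N.lineData l ω)) ∂μ =
      expNeg (lineExponent lamV p Pt α c r) := by
  have hind : Indep (N.nodes l).sigma
      (⨆ i, MeasurableSpace.comap (N.mark l i) inferInstance) μ := by
    refine indep_of_indep_of_le_right (indep_of_indep_of_le_left
      (hN.indep_of_disjoint (S := {.nodes l}) (T := range (.active l) ∪ range (.fading l))
        (by simp)) ?_) (iSup_le fun i => N.comap_mark_le l i (by simp) (by simp))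
    exact le_iSup₂_of_le (.nodes l) rfl le_rfl
  have hg : Measurable (Function.uncurry fun (t : ℝ) y => c * nodePower Pt α r t y) :=
    ((measurable_nodePower Pt α).comp (f := fun z : ℝ × (Bool × ℝ) => (r, z))
      (by fun_prop)).const_mul c
  have hAH : ∀ i, IndepFun (N.active l i) (N.fading l i) μ := fun i =>
    hN.indep.indep (i := .active l i) (j := .fading l i) (by simp)
  have : SigmaFinite (ENNReal.ofReal lamV • (volume : Measure ℝ)) :=
    inferInstanceAs (SigmaFinite (lamV.toNNReal • (volume : Measure ℝ)))
  have key := (hN.nodes_poisson l).lintegral_expNeg_markedSum (hN.measurable_mark l)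
    (hN.iIndepFun_mark l) hind hg (fun i t => lintegral_expNeg_mark (hN.measurable_active l i)
      (hN.measurable_fading l i) (hAH i) (hN.active_law l i) (hN.fading_law l i) hPt α c r t)
  have hmul : ∀ ω, c * linePower Pt α r (N.lineData l ω) =
      PointProcess.markedSum (fun (t : ℝ) y => c * nodePower Pt α r t y)
        ((N.nodes l).data ω) (fun i => N.mark l i ω) := fun ω =>
    PointProcess.mul_markedSum _ _ _ _
  simp_rw [hmul]
  rw [key, lintegral_smul_measure, lineExponent, smul_eq_mul]
  congr 2
  refine lintegral_congr fun t => ?_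
  have hP : ENNReal.ofReal p ≤ 1 := by simpa using hp1
  set v := (1 + c * ENNReal.ofReal Pt * pathLoss α r t)⁻¹ with hv
  have hv1 : v ≤ 1 := by simp [hv]
  symm
  refine ENNReal.eq_sub_of_add_eq ?_ ?_
  · exact ENNReal.add_ne_top.2 ⟨ENNReal.mul_ne_top ENNReal.ofReal_ne_top
      (ne_top_of_le_ne_top ENNReal.one_ne_top hv1), by simp⟩
  · rw [← add_assoc, ← mul_add, tsub_add_cancel_of_le hv1, mul_one, add_tsub_cancel_of_le hP]

/-- The Laplace transform of the interference from all the lines of the line process. -/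
lemma lintegral_expNeg_otherInterference (hN : N.IsCoxBipolar μ lamL lamV p)
    (hp1 : p ≤ 1) {Pt : ℝ} (hPt : 0 ≤ Pt) (α : ℝ) (c : ℝ≥0∞) :
    ∫⁻ ω, expNeg (c * N.otherInterference Pt α ω) ∂μ =
      expNeg (ENNReal.ofReal lamL * (ENNReal.ofReal (2 * Real.pi) *
        ∫⁻ r in Ioi 0, (1 - expNeg (lineExponent lamV p Pt α c r)))) := by
  have hind : Indep N.lines.sigma
      (⨆ j : ℕ, MeasurableSpace.comap (N.lineData (some j)) inferInstance) μ := by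
    refine indep_of_indep_of_le_right (indep_of_indep_of_le_left
      (hN.indep_of_disjoint (S := {.lines}) (T := ⋃ j : ℕ, lineSources (some j))
        (by simp [lineSources])) ?_)
        (iSup_le fun j => N.comap_lineData_le _ (subset_iUnion_of_subset j subset_rfl))
    exact le_iSup₂_of_le .lines rfl le_rfl
  have hg : Measurable (Function.uncurry fun (z : ℝ × ℝ) D => c * linePower Pt α z.1 D) :=
    ((measurable_linePower Pt α).comp
      (f := fun z : (ℝ × ℝ) × ((ℕ∞ × (ℕ → ℝ)) × (ℕ → Bool × ℝ)) => (z.1.1, z.2))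
      (by fun_prop)).const_mul c
  have : SigmaFinite (ENNReal.ofReal lamL • (volume : Measure (ℝ × ℝ)).restrict
      (Ici 0 ×ˢ Ico 0 (2 * Real.pi))) :=
    inferInstanceAs (SigmaFinite (lamL.toNNReal • (volume : Measure (ℝ × ℝ)).restrict
      (Ici 0 ×ˢ Ico 0 (2 * Real.pi))))
  have key := hN.lines_poisson.lintegral_expNeg_markedSum
    (fun j : ℕ => hN.measurable_lineData (some j)) hN.iIndepFun_lineData hind hg
    (fun j z => hN.lintegral_expNeg_linePower hp1 hPt α z.1 c (some j))
  have hmul : ∀ ω, c * N.otherInterference Pt α ω =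
      PointProcess.markedSum (fun (z : ℝ × ℝ) D => c * linePower Pt α z.1 D)
        (N.lines.data ω) (fun j => N.lineData (some j) ω) := fun ω => by
    rw [otherInterference_eq]
    exact PointProcess.mul_markedSum _ _ _ _
  simp_rw [hmul]
  have hm : Measurable fun r => 1 - expNeg (lineExponent lamV p Pt α c r) :=
    measurable_const.sub (measurable_expNeg.comp (measurable_lineExponent _ _ _ _ _))
  rw [key, lintegral_smul_measure, smul_eq_mul, Measure.volume_eq_prod, ← Measure.prod_restrict,
    lintegral_prod (fun z : ℝ × ℝ => 1 - expNeg (lineExponent lamV p Pt α c z.1))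
      (hm.comp measurable_fst).aemeasurable]
  simp only [lintegral_const, Measure.restrict_apply_univ, Real.volume_Ico, sub_zero]
  rw [lintegral_mul_const _ hm, mul_comm (lintegral _ _), setLIntegral_congr Ioi_ae_eq_Ici]

end IsCoxBipolar

end Network

/-! ### The exponents as convergent integrals -/

section Integrals

variable {α c : ℝ}

/-- In the applications `m` is the norm of `x` or of `(y, x)`, and `q = y ^ 2 + x ^ 2`. -/
lemma one_div_one_add_mul_rpow_le (hα : 0 ≤ α) (hc : 0 < c) {m q : ℝ} (hm : 0 ≤ m)
    (hmq : m ^ 2 ≤ q) :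
    1 / (1 + c * q ^ (α / 2)) ≤ 2 ^ α * max 1 c⁻¹ * (1 + m) ^ (-α) := by
  have hq : 0 ≤ q := (sq_nonneg m).trans hmq
  have h1 : m ^ α ≤ q ^ (α / 2) := by
    calc m ^ α = (m ^ 2) ^ (α / 2) := by
          rw [← Real.rpow_natCast, ← Real.rpow_mul hm]; congr 1; push_cast; ring
      _ ≤ q ^ (α / 2) := Real.rpow_le_rpow (by positivity) hmq (by positivity)
  have h2 : (1 + m) ^ α ≤ 2 ^ α * (1 + m ^ α) := by
    calc (1 + m) ^ α ≤ (2 * max 1 m) ^ α := by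
          refine Real.rpow_le_rpow (by positivity) ?_ hα
          linarith [le_max_left 1 m, le_max_right 1 m]
      _ = 2 ^ α * (max 1 m) ^ α := Real.mul_rpow (by norm_num) (by positivity)
      _ ≤ 2 ^ α * (1 + m ^ α) := by
          gcongr
          have := Real.rpow_nonneg hm α
          rcases max_choice 1 m with h | h <;> rw [h]
          · rw [Real.one_rpow]; linarith
          · linarith
  have h3 : 1 + m ^ α ≤ max 1 c⁻¹ * (1 + c * q ^ (α / 2)) := by
    have hQ : 0 ≤ q ^ (α / 2) := by positivity
    have : q ^ (α / 2) ≤ max 1 c⁻¹ * (c * q ^ (α / 2)) := by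
      calc q ^ (α / 2) = c⁻¹ * (c * q ^ (α / 2)) := by field_simp
        _ ≤ _ := by gcongr; exact le_max_right _ _
    linarith [le_max_left 1 c⁻¹]
  rw [Real.rpow_neg (by positivity), ← div_eq_mul_inv, div_le_div_iff₀ (by positivity)
    (by positivity), one_mul]
  calc (1 + m) ^ α ≤ 2 ^ α * (1 + m ^ α) := h2
    _ ≤ 2 ^ α * (max 1 c⁻¹ * (1 + c * q ^ (α / 2))) := by gcongr
    _ = _ := by ring

lemma integrable_prod_one_div_one_add_mul_rpow (hα : 2 < α) (hc : 0 < c) :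
    Integrable fun z : ℝ × ℝ => 1 / (1 + c * (z.1 ^ 2 + z.2 ^ 2) ^ (α / 2)) := by
  have h := (integrable_one_add_norm (E := ℝ × ℝ) (μ := volume) (r := α)
    (by simpa using hα)).const_mul (2 ^ α * max 1 c⁻¹)
  refine h.mono' (by fun_prop : Measurable _).aestronglyMeasurable (.of_forall fun z => ?_)
  rw [Real.norm_of_nonneg (by positivity)]
  refine one_div_one_add_mul_rpow_le (by linarith) hc (norm_nonneg _) ?_
  rcases max_choice ‖z.1‖ ‖z.2‖ with h | h <;>
    rw [Prod.norm_def, h, Real.norm_eq_abs, sq_abs] <;> nlinarith [sq_nonneg z.1, sq_nonneg z.2]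

lemma integrable_one_div_one_add_mul_rpow (hα : 1 < α) (hc : 0 < c) (y : ℝ) :
    Integrable fun x : ℝ => 1 / (1 + c * (y ^ 2 + x ^ 2) ^ (α / 2)) := by
  have h := (integrable_one_add_norm (E := ℝ) (μ := volume) (r := α)
    (by simpa using hα)).const_mul (2 ^ α * max 1 c⁻¹)
  refine h.mono' (by fun_prop : Measurable _).aestronglyMeasurable (.of_forall fun x => ?_)
  rw [Real.norm_of_nonneg (by positivity)]
  refine one_div_one_add_mul_rpow_le (by linarith) hc (norm_nonneg _) ?_
  rw [Real.norm_eq_abs, sq_abs]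
  nlinarith [sq_nonneg y]

/-- The two halves of a line, cut at the foot of the perpendicular, contribute equally. -/
lemma integral_eq_two_mul_setIntegral_Ioi (y : ℝ) :
    ∫ x : ℝ, 1 / (1 + c * (y ^ 2 + x ^ 2) ^ (α / 2)) =
      2 * ∫ x in Ioi (0 : ℝ), 1 / (1 + c * (y ^ 2 + x ^ 2) ^ (α / 2)) := by
  rw [← integral_comp_abs (f := fun x => 1 / (1 + c * (y ^ 2 + x ^ 2) ^ (α / 2)))]
  simp_rw [sq_abs]

lemma integrable_one_sub_exp_setIntegral (hα : 2 < α) (hc : 0 < c) {a : ℝ} (ha : 0 ≤ a) :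
    Integrable fun y : ℝ =>
      1 - Real.exp (-(a * ∫ x in Ioi (0 : ℝ), 1 / (1 + c * (y ^ 2 + x ^ 2) ^ (α / 2)))) := by
  have h := (integrable_prod_one_div_one_add_mul_rpow hα hc).integral_prod_left
  simp only [integral_eq_two_mul_setIntegral_Ioi] at h
  have hint : Integrable fun y : ℝ =>
      a * ∫ x in Ioi (0 : ℝ), 1 / (1 + c * (y ^ 2 + x ^ 2) ^ (α / 2)) := by
    convert h.const_mul (a / 2) using 2
    ring
  refine hint.mono' ?_ (.of_forall fun y => ?_)
  · exact aestronglyMeasurable_const.sub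
      (Real.continuous_exp.comp_aestronglyMeasurable hint.aestronglyMeasurable.neg)
  · have h0 : 0 ≤ a * ∫ x in Ioi (0 : ℝ), 1 / (1 + c * (y ^ 2 + x ^ 2) ^ (α / 2)) :=
      mul_nonneg ha (integral_nonneg fun x => by positivity)
    rw [Real.norm_of_nonneg (by simpa using h0)]
    linarith [Real.add_one_le_exp
      (-(a * ∫ x in Ioi (0 : ℝ), 1 / (1 + c * (y ^ 2 + x ^ 2) ^ (α / 2))))]

end Integrals

section Exponents

variable {lamV p Pt α s : ℝ}

/-- A node at the origin has infinite path loss factor, and the identity holds there with both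
sides equal to one. -/
lemma one_sub_inv_one_add_pathLoss (hα : 0 < α) (hPt : 0 < Pt) (hs : 0 < s) (r t : ℝ) :
    1 - (1 + ENNReal.ofReal s * ENNReal.ofReal Pt * pathLoss α r t)⁻¹ =
      ENNReal.ofReal (1 / (1 + (s * Pt)⁻¹ * (r ^ 2 + t ^ 2) ^ (α / 2))) := by
  have hsP : 0 < s * Pt := mul_pos hs hPt
  rw [← ENNReal.ofReal_mul hs.le, pathLoss]
  rcases (by positivity : 0 ≤ r ^ 2 + t ^ 2).eq_or_lt with hq | hq
  · rw [← hq, Real.sqrt_zero, ENNReal.ofReal_zero, ENNReal.zero_rpow_of_neg (by linarith),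
      ENNReal.mul_top (by simpa using hsP), Real.zero_rpow (by positivity)]
    simp
  · have hQ : √(r ^ 2 + t ^ 2) ^ (-α) = ((r ^ 2 + t ^ 2) ^ (α / 2))⁻¹ := by
      rw [Real.sqrt_eq_rpow, ← Real.rpow_mul hq.le, ← Real.rpow_neg hq.le]
      congr 1; ring
    have hQ0 : 0 < (r ^ 2 + t ^ 2) ^ (α / 2) := by positivity
    rw [ENNReal.ofReal_rpow_of_pos (Real.sqrt_pos.2 hq), hQ, ← ENNReal.ofReal_mul hsP.le,
      ← ENNReal.ofReal_one, ← ENNReal.ofReal_add zero_le_one (by positivity),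
      ← ENNReal.ofReal_inv_of_pos (by positivity), ← ENNReal.ofReal_sub _ (by positivity)]
    congr 1
    field_simp
    ring

lemma lineExponent_ofReal (hlamV : 0 ≤ lamV) (hp : 0 ≤ p) (hα : 1 < α) (hPt : 0 < Pt)
    (hs : 0 < s) (r : ℝ) :
    lineExponent lamV p Pt α (ENNReal.ofReal s) r = ENNReal.ofReal (2 * p * lamV *
      ∫ x in Ioi (0 : ℝ), 1 / (1 + (s * Pt)⁻¹ * (r ^ 2 + x ^ 2) ^ (α / 2))) := by
  have hc : 0 < (s * Pt)⁻¹ := by positivity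
  simp_rw [lineExponent, one_sub_inv_one_add_pathLoss (by linarith : 0 < α) hPt hs]
  rw [lintegral_const_mul' _ _ ENNReal.ofReal_ne_top,
    ← ofReal_integral_eq_lintegral_ofReal (integrable_one_div_one_add_mul_rpow hα hc r)
      (.of_forall fun x => by positivity), integral_eq_two_mul_setIntegral_Ioi,
    ← ENNReal.ofReal_mul hp, ← ENNReal.ofReal_mul hlamV]
  congr 1
  ring

lemma expNeg_lineExponent_ofReal (hlamV : 0 ≤ lamV) (hp : 0 ≤ p) (hα : 1 < α) (hPt : 0 < Pt)
    (hs : 0 < s) (r : ℝ) :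
    expNeg (lineExponent lamV p Pt α (ENNReal.ofReal s) r) = ENNReal.ofReal (Real.exp
      (-(2 * p * lamV *
        ∫ x in Ioi (0 : ℝ), 1 / (1 + (s * Pt)⁻¹ * (r ^ 2 + x ^ 2) ^ (α / 2))))) := by
  rw [lineExponent_ofReal hlamV hp hα hPt hs, expNeg_ofReal]
  exact mul_nonneg (by positivity) (integral_nonneg fun x => by positivity)

lemma lintegral_one_sub_expNeg_lineExponent (hlamV : 0 ≤ lamV) (hp : 0 ≤ p) (hα : 2 < α)
    (hPt : 0 < Pt) (hs : 0 < s) :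
    ∫⁻ r in Ioi 0, (1 - expNeg (lineExponent lamV p Pt α (ENNReal.ofReal s) r)) =
      ENNReal.ofReal (∫ r in Ioi (0 : ℝ), (1 - Real.exp (-(2 * p * lamV *
        ∫ x in Ioi (0 : ℝ), 1 / (1 + (s * Pt)⁻¹ * (r ^ 2 + x ^ 2) ^ (α / 2)))))) := by
  have hc : 0 < (s * Pt)⁻¹ := by positivity
  rw [ofReal_integral_eq_lintegral_ofReal
    (integrable_one_sub_exp_setIntegral hα hc (by positivity)).integrableOn]
  · refine lintegral_congr fun r => ?_
    rw [expNeg_lineExponent_ofReal hlamV hp (by linarith) hPt hs,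
      ENNReal.ofReal_sub _ (Real.exp_pos _).le, ENNReal.ofReal_one]
  · refine .of_forall fun r => ?_
    have : 0 ≤ 2 * p * lamV *
        ∫ x in Ioi (0 : ℝ), 1 / (1 + (s * Pt)⁻¹ * (r ^ 2 + x ^ 2) ^ (α / 2)) :=
      mul_nonneg (by positivity) (integral_nonneg fun x => by positivity)
    simpa using this

lemma lineExponent_mono (lamV p Pt α r : ℝ) : Monotone fun c => lineExponent lamV p Pt α c r := by
  intro c c' h
  simp only [lineExponent]
  gcongr

lemma tendsto_lineExponent_zero (hp : 0 ≤ p) (hα : 1 < α) (hPt : 0 < Pt)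
    {c : ℕ → ℝ≥0∞} (hc1 : ∀ n, c n ≤ 1) (hc : Filter.Tendsto c Filter.atTop (nhds 0)) (r : ℝ) :
    Filter.Tendsto (fun n => lineExponent lamV p Pt α (c n) r) Filter.atTop (nhds 0) := by
  have hm : ∀ b : ℝ≥0∞, Measurable fun t : ℝ =>
      ENNReal.ofReal p * (1 - (1 + b * ENNReal.ofReal Pt * pathLoss α r t)⁻¹) := fun b =>
    (measurable_const.sub ((((measurable_pathLoss α).comp
      (f := fun t : ℝ => (r, t)) (by fun_prop)).const_mul _).const_add _).inv).const_mul _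
  have hfin : ∫⁻ t : ℝ,
      ENNReal.ofReal p * (1 - (1 + 1 * ENNReal.ofReal Pt * pathLoss α r t)⁻¹) ≠ ∞ := by
    have := lineExponent_ofReal zero_le_one hp hα hPt one_pos r
    rw [lineExponent, ENNReal.ofReal_one, one_mul] at this
    rw [this]
    exact ENNReal.ofReal_ne_top
  have h := tendsto_lintegral_of_dominated_convergence
    (F := fun n (t : ℝ) =>
      ENNReal.ofReal p * (1 - (1 + c n * ENNReal.ofReal Pt * pathLoss α r t)⁻¹))
    (f := fun _ => 0) (μ := volume) _ (fun n => hm (c n))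
    (fun n => .of_forall fun t => by dsimp only; gcongr; exact hc1 n) hfin ?_
  · have h' := ENNReal.Tendsto.const_mul (a := ENNReal.ofReal lamV) h (.inr ENNReal.ofReal_ne_top)
    simpa [lineExponent] using h'
  · have h0 : ∀ᵐ t : ℝ, t ≠ 0 := by simp [ae_iff]
    filter_upwards [h0] with t ht
    have hL : pathLoss α r t ≠ ∞ := by
      refine ENNReal.rpow_ne_top_of_ne_zero ?_ ENNReal.ofReal_ne_top
      rw [ne_eq, ENNReal.ofReal_eq_zero, not_le]
      positivity
    have h1 : Filter.Tendsto (fun n => c n * ENNReal.ofReal Pt * pathLoss α r t) Filter.atTop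
        (nhds (0 * ENNReal.ofReal Pt * pathLoss α r t)) :=
      ENNReal.Tendsto.mul_const (ENNReal.Tendsto.mul_const hc (.inr ENNReal.ofReal_ne_top))
        (.inr hL)
    have h2 := ENNReal.Tendsto.const_mul (a := ENNReal.ofReal p) (ENNReal.Tendsto.sub
      (tendsto_const_nhds (x := (1 : ℝ≥0∞))) (h1.const_add 1).inv (.inl ENNReal.one_ne_top))
      (.inr ENNReal.ofReal_ne_top)
    simpa using h2

lemma tendsto_lintegral_one_sub_expNeg_lineExponent (hlamV : 0 ≤ lamV) (hp : 0 ≤ p) (hα : 2 < α)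
    (hPt : 0 < Pt) {c : ℕ → ℝ≥0∞} (hc1 : ∀ n, c n ≤ 1)
    (hc : Filter.Tendsto c Filter.atTop (nhds 0)) :
    Filter.Tendsto (fun n => ∫⁻ r in Ioi 0, (1 - expNeg (lineExponent lamV p Pt α (c n) r)))
      Filter.atTop (nhds 0) := by
  have hfin : ∫⁻ r in Ioi (0 : ℝ), (1 - expNeg (lineExponent lamV p Pt α 1 r)) ≠ ∞ := by
    have := lintegral_one_sub_expNeg_lineExponent hlamV hp hα hPt one_pos
    rw [ENNReal.ofReal_one] at this
    rw [this]
    exact ENNReal.ofReal_ne_top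
  have h := tendsto_lintegral_of_dominated_convergence
    (F := fun n (r : ℝ) => 1 - expNeg (lineExponent lamV p Pt α (c n) r))
    (f := fun _ => 0) (μ := volume.restrict (Ioi 0)) _
    (fun n => measurable_const.sub (measurable_expNeg.comp
      (measurable_lineExponent _ _ _ _ _)))
    (fun n => .of_forall fun r => tsub_le_tsub_left
      (antitone_expNeg (lineExponent_mono lamV p Pt α r (hc1 n))) _) hfin
    (.of_forall fun r => ?_)
  · simpa using h
  · have h1 := (continuous_expNeg.tendsto 0).comp
      (tendsto_lineExponent_zero (lamV := lamV) (α := α) hp (by linarith) hPt hc1 hc r)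
    have h2 := ENNReal.Tendsto.sub (tendsto_const_nhds (x := (1 : ℝ≥0∞))) h1
      (.inl ENNReal.one_ne_top)
    simpa using h2

end Exponents

/-! ### Finiteness of the interference and the success probability -/

section Laplace

variable {Ω : Type*} [MeasurableSpace Ω] {μ : Measure Ω}

/-- A random variable in `[0, ∞]` is almost surely finite if its Laplace transform, which only
sees the event where it is finite, tends to one along some sequence of positive arguments. -/
lemma ae_lt_top_of_lintegral_expNeg [IsProbabilityMeasure μ] {I : Ω → ℝ≥0∞}
    (hI : Measurable I) {c Λ : ℕ → ℝ≥0∞} (hc : ∀ n, c n ≠ 0)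
    (h : ∀ n, ∫⁻ ω, expNeg (c n * I ω) ∂μ = expNeg (Λ n))
    (hΛ : Filter.Tendsto Λ Filter.atTop (nhds 0)) : ∀ᵐ ω ∂μ, I ω < ∞ := by
  have hs : MeasurableSet {ω | I ω < ∞} := hI measurableSet_Iio
  have hle : ∀ n, expNeg (Λ n) ≤ μ {ω | I ω < ∞} := fun n => by
    rw [← h n, ← lintegral_indicator_one hs]
    refine lintegral_mono fun ω => ?_
    by_cases hω : I ω = ∞
    · simp [hω, ENNReal.mul_top (hc n)]
    · simpa [indicator, lt_top_iff_ne_top, hω] using expNeg_le_one _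
  have hlim := (continuous_expNeg.tendsto 0).comp hΛ
  rw [expNeg_zero] at hlim
  exact (mem_ae_iff_prob_eq_one hs).2 (le_antisymm prob_le_one (le_of_tendsto' hlim hle))

/-- Finiteness is needed because `laplace` sends the value `∞` of `I` to `exp 0 = 1`, and `expNeg`
sends it to `0`. -/
lemma laplace_eq_toReal_lintegral {I : Ω → ℝ≥0∞} (hI : Measurable I) (hfin : ∀ᵐ ω ∂μ, I ω < ∞)
    {s : ℝ} (hs : 0 ≤ s) :
    laplace μ I s = (∫⁻ ω, expNeg (ENNReal.ofReal s * I ω) ∂μ).toReal := by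
  rw [laplace, integral_eq_lintegral_of_nonneg_ae (.of_forall fun ω => (Real.exp_pos _).le)
    (by fun_prop : Measurable _).aestronglyMeasurable]
  congr 1
  refine lintegral_congr_ae ?_
  filter_upwards [hfin] with ω hω
  rw [expNeg_eq_ofReal (ENNReal.mul_ne_top ENNReal.ofReal_ne_top hω.ne), ENNReal.toReal_mul,
    ENNReal.toReal_ofReal hs]

end Laplace

namespace Network.IsCoxBipolar

variable {Ω : Type*} [MeasurableSpace Ω] {μ : Measure Ω} {N : Network Ω} {lamL lamV p : ℝ}

lemma measurable_typicalInterference (hN : N.IsCoxBipolar μ lamL lamV p) (Pt α : ℝ) :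
    Measurable (N.typicalInterference Pt α) := by
  rw [funext (N.typicalInterference_eq Pt α)]
  exact (measurable_linePower_right Pt α 0).comp (hN.measurable_lineData none)

lemma measurable_otherInterference (hN : N.IsCoxBipolar μ lamL lamV p) (Pt α : ℝ) :
    Measurable (N.otherInterference Pt α) := by
  rw [funext (N.otherInterference_eq Pt α)]
  exact (measurable_linesPower Pt α).comp hN.measurable_otherData

lemma indepFun_lineData_otherData (hN : N.IsCoxBipolar μ lamL lamV p) :
    IndepFun (N.lineData none) N.otherData μ := by
  have hd : Disjoint (lineSources none) ({.lines} ∪ ⋃ j : ℕ, lineSources (some j)) := by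
    rw [disjoint_union_right, disjoint_iUnion_right]
    exact ⟨by simp [lineSources], fun j => disjoint_lineSources (by simp)⟩
  exact indep_of_indep_of_le_right (indep_of_indep_of_le_left (hN.indep_of_disjoint hd)
    (N.comap_lineData_le none subset_rfl)) (N.comap_otherData_le (by simp)
      fun j => (subset_iUnion (fun j : ℕ => lineSources (some j)) j).trans subset_union_right)

lemma indepFun_data_linkFading (hN : N.IsCoxBipolar μ lamL lamV p) :
    IndepFun (fun ω => (N.lineData none ω, N.otherData ω)) N.linkFading μ := by
  have hd : Disjoint (lineSources none ∪ ({.lines} ∪ ⋃ j : ℕ, lineSources (some j)))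
      {Source.linkFading} := by
    simp [lineSources]
  refine indep_of_indep_of_le_right (indep_of_indep_of_le_left (hN.indep_of_disjoint hd) ?_)
    (le_iSup₂_of_le .linkFading rfl le_rfl)
  rw [Prod.instMeasurableSpace, MeasurableSpace.prod, MeasurableSpace.comap_sup,
    MeasurableSpace.comap_comp, MeasurableSpace.comap_comp]
  exact sup_le (N.comap_lineData_le none subset_union_left) (N.comap_otherData_le (by simp)
    fun j => ((subset_iUnion (fun j : ℕ => lineSources (some j)) j).trans subset_union_right).trans
      subset_union_right)

lemma indepFun_interference (hN : N.IsCoxBipolar μ lamL lamV p) (Pt α : ℝ) :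
    IndepFun (N.typicalInterference Pt α) (N.otherInterference Pt α) μ := by
  rw [funext (N.typicalInterference_eq Pt α), funext (N.otherInterference_eq Pt α)]
  exact hN.indepFun_lineData_otherData.comp
    (measurable_linePower_right Pt α 0) (measurable_linesPower Pt α)

lemma indepFun_interference_linkFading (hN : N.IsCoxBipolar μ lamL lamV p) (Pt α : ℝ) :
    IndepFun (fun ω => N.typicalInterference Pt α ω + N.otherInterference Pt α ω)
      N.linkFading μ := by
  simp_rw [typicalInterference_eq, otherInterference_eq]
  exact hN.indepFun_data_linkFading.comp
    (φ := linePower Pt α 0 ∘ Prod.fst + linesPower Pt α ∘ Prod.snd)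
    (((measurable_linePower_right Pt α 0).comp measurable_fst).add
      ((measurable_linesPower Pt α).comp measurable_snd)) measurable_id

lemma lintegral_expNeg_typicalInterference [IsProbabilityMeasure μ]
    (hN : N.IsCoxBipolar μ lamL lamV p) (hp1 : p ≤ 1) {Pt : ℝ} (hPt : 0 ≤ Pt) (α : ℝ) (c : ℝ≥0∞) :
    ∫⁻ ω, expNeg (c * N.typicalInterference Pt α ω) ∂μ =
      expNeg (lineExponent lamV p Pt α c 0) := by
  simp_rw [typicalInterference_eq]
  exact hN.lintegral_expNeg_linePower hp1 hPt α 0 c none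

/-- Both interference powers are almost surely finite, because their Laplace transforms tend to
one at zero. -/
lemma ae_interference_lt_top [IsProbabilityMeasure μ]
    (hN : N.IsCoxBipolar μ lamL lamV p) (hlamV : 0 ≤ lamV) (hp0 : 0 ≤ p) (hp1 : p ≤ 1)
    {Pt α : ℝ} (hPt : 0 < Pt) (hα : 2 < α) :
    (∀ᵐ ω ∂μ, N.typicalInterference Pt α ω < ∞) ∧ ∀ᵐ ω ∂μ, N.otherInterference Pt α ω < ∞ := by
  let c : ℕ → ℝ≥0∞ := fun n => ((n : ℝ≥0∞) + 1)⁻¹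
  have hc0 : ∀ n, c n ≠ 0 := fun n => by simp [c]
  have hc1 : ∀ n, c n ≤ 1 := fun n => by simp [c]
  have hc : Filter.Tendsto c Filter.atTop (nhds 0) := by
    have := (Filter.tendsto_add_atTop_iff_nat 1).2 ENNReal.tendsto_inv_nat_nhds_zero
    simpa [c] using this
  refine ⟨ae_lt_top_of_lintegral_expNeg (hN.measurable_typicalInterference Pt α) hc0
    (fun n => hN.lintegral_expNeg_typicalInterference hp1 hPt.le α (c n))
    (tendsto_lineExponent_zero hp0 (by linarith) hPt hc1 hc 0),
    ae_lt_top_of_lintegral_expNeg (hN.measurable_otherInterference Pt α) hc0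
    (fun n => hN.lintegral_expNeg_otherInterference hp1 hPt.le α (c n)) ?_⟩
  have h := ENNReal.Tendsto.const_mul (a := ENNReal.ofReal lamL) (ENNReal.Tendsto.const_mul
    (a := ENNReal.ofReal (2 * Real.pi))
    (tendsto_lintegral_one_sub_expNeg_lineExponent hlamV hp0 hα hPt hc1 hc)
    (.inr ENNReal.ofReal_ne_top)) (.inr ENNReal.ofReal_ne_top)
  simpa using h

/-- Conditionally on the interference, the link succeeds when the fading gain of the link, which is
exponential, exceeds a multiple of the noise plus interference. -/
lemma measure_lt_sinr [IsProbabilityMeasure μ] (hN : N.IsCoxBipolar μ lamL lamV p)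
    {Pt α d σ β : ℝ} (hPt : 0 < Pt) (hd : 0 < d) (hβ : 0 < β) :
    μ {ω | ENNReal.ofReal β < N.sinr Pt α d σ ω} =
      expNeg (ENNReal.ofReal (β * d ^ α / Pt) * ENNReal.ofReal (σ ^ 2)) *
        ((∫⁻ ω, expNeg (ENNReal.ofReal (β * d ^ α / Pt) * N.typicalInterference Pt α ω) ∂μ) *
        ∫⁻ ω, expNeg (ENNReal.ofReal (β * d ^ α / Pt) * N.otherInterference Pt α ω) ∂μ) := by
  set c := ENNReal.ofReal (β * d ^ α / Pt) with hc
  have hm0 := hN.measurable_typicalInterference Pt α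
  have hm1 := hN.measurable_otherInterference Pt α
  have hK : 0 < Pt * d ^ (-α) := by positivity
  have hevent : {ω | ENNReal.ofReal β < N.sinr Pt α d σ ω} =
      {ω | c * (N.typicalInterference Pt α ω + N.otherInterference Pt α ω +
        ENNReal.ofReal (σ ^ 2)) < ENNReal.ofReal (N.linkFading ω)} := by
    ext ω
    have hβK : ENNReal.ofReal β = ENNReal.ofReal (Pt * d ^ (-α)) * c := by
      rw [hc, ← ENNReal.ofReal_mul hK.le, Real.rpow_neg hd.le]
      congr 1
      field_simp
    have hS : ENNReal.ofReal (Pt * N.linkFading ω * d ^ (-α)) =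
        ENNReal.ofReal (Pt * d ^ (-α)) * ENNReal.ofReal (N.linkFading ω) := by
      rw [← ENNReal.ofReal_mul hK.le]
      congr 1
      ring
    rw [mem_ofPred_eq, mem_ofPred_eq, sinr,
      ENNReal.lt_div_iff_mul_lt (.inr ENNReal.ofReal_ne_top) (.inr (by simpa using hβ)),
      hS, hβK, mul_assoc,
      ENNReal.mul_lt_mul_iff_right (by simpa using hK) ENNReal.ofReal_ne_top]
  have hF : Measurable (Function.uncurry fun (x : ℝ≥0∞) (h : ℝ) =>
      {z : ℝ≥0∞ × ℝ | c * (z.1 + ENNReal.ofReal (σ ^ 2)) < ENNReal.ofReal z.2}.indicator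
        (1 : ℝ≥0∞ × ℝ → ℝ≥0∞) (x, h)) :=
    measurable_one.indicator (measurableSet_lt (by fun_prop) (by fun_prop))
  have hset : ∀ x : Ω → ℝ≥0∞, Measurable x → MeasurableSet
      {ω | c * (x ω + ENNReal.ofReal (σ ^ 2)) < ENNReal.ofReal (N.linkFading ω)} := fun x hx =>
    measurableSet_lt ((hx.add_const _).const_mul _) hN.measurable_linkFading.ennreal_ofReal
  have hpair := lintegral_indepFun_pair (hm0.add hm1) hN.measurable_linkFading
    (hN.indepFun_interference_linkFading Pt α) hF
  rw [hevent]
  refine (lintegral_indicator_one (hset _ (hm0.add hm1))).symm.trans (hpair.trans ?_)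
  have hinner : ∀ ω, ∫⁻ ω', {z : ℝ≥0∞ × ℝ | c * (z.1 + ENNReal.ofReal (σ ^ 2)) <
      ENNReal.ofReal z.2}.indicator (1 : ℝ≥0∞ × ℝ → ℝ≥0∞)
        ((N.typicalInterference Pt α + N.otherInterference Pt α) ω, N.linkFading ω') ∂μ =
      expNeg (c * ENNReal.ofReal (σ ^ 2)) * (expNeg (c * N.typicalInterference Pt α ω) *
        expNeg (c * N.otherInterference Pt α ω)) := by
    intro ω
    rw [← expNeg_add, ← expNeg_add, ← mul_add, ← mul_add, add_comm (ENNReal.ofReal _),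
      ← measure_lt_ofReal_of_map_eq_expMeasure hN.measurable_linkFading hN.linkFading_law,
      ← lintegral_indicator_one (hset _ measurable_const)]
    rfl
  refine (lintegral_congr hinner).trans ?_
  rw [lintegral_const_mul' _ _ (expNeg_ne_top _)]
  congr 1
  have hE : Measurable fun x => expNeg (c * x) := measurable_expNeg.comp (by fun_prop)
  exact lintegral_mul_eq_lintegral_mul_lintegral_of_indepFun (hE.comp hm0) (hE.comp hm1)
    ((hN.indepFun_interference Pt α).comp hE hE)

end Network.IsCoxBipolar

end CoxBipolar

theorem theorem1 {Ω : Type*} [MeasurableSpace Ω] (μ : Measure Ω) [IsProbabilityMeasure μ]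
    (lamL lamV p Pt α d σ β : ℝ) (hlamL : 0 ≤ lamL) (hlamV : 0 ≤ lamV) (hp0 : 0 ≤ p) (hp1 : p ≤ 1)
    (hPt : 0 < Pt) (hα : 2 < α) (hd : 0 < d) (hβ : 0 < β)
    (N : CoxBipolar.Network Ω) (hN : N.IsCoxBipolar μ lamL lamV p) :
    -- both interference powers are almost surely finite
    (∀ᵐ ω ∂μ, N.typicalInterference Pt α ω < ∞ ∧ N.otherInterference Pt α ω < ∞) ∧
    -- the Laplace transform of the interference from the typical line
    (∀ s : ℝ, 0 < s →
      IntegrableOn (fun x : ℝ => 1 / (1 + (s * Pt)⁻¹ * x ^ α)) (Ioi 0) ∧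
      CoxBipolar.laplace μ (N.typicalInterference Pt α) s =
        Real.exp (-2 * p * lamV * ∫ x in Ioi (0 : ℝ), 1 / (1 + (s * Pt)⁻¹ * x ^ α))) ∧
    -- the Laplace transform of the interference from the other lines
    (∀ s : ℝ, 0 < s →
      (∀ y : ℝ, IntegrableOn
        (fun x : ℝ => 1 / (1 + s⁻¹ * Pt⁻¹ * (y ^ 2 + x ^ 2) ^ (α / 2))) (Ioi 0)) ∧
      IntegrableOn (fun y : ℝ => 1 - Real.exp (-2 * p * lamV *
        ∫ x in Ioi (0 : ℝ), 1 / (1 + s⁻¹ * Pt⁻¹ * (y ^ 2 + x ^ 2) ^ (α / 2)))) (Ioi 0) ∧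
      CoxBipolar.laplace μ (N.otherInterference Pt α) s =
        Real.exp (-2 * Real.pi * lamL * ∫ y in Ioi (0 : ℝ), (1 - Real.exp (-2 * p * lamV *
          ∫ x in Ioi (0 : ℝ), 1 / (1 + s⁻¹ * Pt⁻¹ * (y ^ 2 + x ^ 2) ^ (α / 2)))))) ∧
    -- the success probability in terms of the Laplace transforms
    μ.real {ω | ENNReal.ofReal β < N.sinr Pt α d σ ω} =
      Real.exp (-(β * σ ^ 2 * d ^ α / Pt)) *
        CoxBipolar.laplace μ (N.typicalInterference Pt α) (β * d ^ α / Pt) *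
        CoxBipolar.laplace μ (N.otherInterference Pt α) (β * d ^ α / Pt) ∧
    -- the explicit formula, whose integrals converge
    IntegrableOn (fun x : ℝ => β * d ^ α * x ^ (-α) / (1 + β * d ^ α * x ^ (-α))) (Ioi 0) ∧
    (∀ y : ℝ, IntegrableOn (fun x : ℝ => β * d ^ α * (y ^ 2 + x ^ 2) ^ (-α / 2) /
      (1 + β * d ^ α * (y ^ 2 + x ^ 2) ^ (-α / 2))) (Ioi 0)) ∧
    IntegrableOn (fun y : ℝ => 1 - Real.exp (-2 * p * lamV *
      ∫ x in Ioi (0 : ℝ), β * d ^ α * (y ^ 2 + x ^ 2) ^ (-α / 2) /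
        (1 + β * d ^ α * (y ^ 2 + x ^ 2) ^ (-α / 2)))) (Ioi 0) ∧
    μ.real {ω | ENNReal.ofReal β < N.sinr Pt α d σ ω} =
      Real.exp (-(β * σ ^ 2 * d ^ α / Pt) -
        2 * p * lamV * (∫ x in Ioi (0 : ℝ),
          β * d ^ α * x ^ (-α) / (1 + β * d ^ α * x ^ (-α))) -
        2 * Real.pi * lamL * ∫ y in Ioi (0 : ℝ), (1 - Real.exp (-2 * p * lamV *
          ∫ x in Ioi (0 : ℝ), β * d ^ α * (y ^ 2 + x ^ 2) ^ (-α / 2) /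
            (1 + β * d ^ α * (y ^ 2 + x ^ 2) ^ (-α / 2))))) := by 
  have h2pl : 0 ≤ 2 * p * lamV := by positivity
  obtain ⟨hfin0, hfin1⟩ := hN.ae_interference_lt_top hlamV hp0 hp1 hPt hα
  have hα1 : 1 < α := by linarith
  have hneg : ∀ x : ℝ, -2 * p * lamV * x = -(2 * p * lamV * x) := fun x => by ring
  have hinv : ∀ s : ℝ, s⁻¹ * Pt⁻¹ = (s * Pt)⁻¹ := fun s => (mul_inv s Pt).symm
  -- the typical line is a line at distance zero
  have hzero : ∀ c : ℝ, EqOn (fun x : ℝ => 1 / (1 + c * ((0 : ℝ) ^ 2 + x ^ 2) ^ (α / 2)))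
      (fun x => 1 / (1 + c * x ^ α)) (Ioi 0) := by
    intro c x hx
    have : ((0 : ℝ) ^ 2 + x ^ 2) ^ (α / 2) = x ^ α := by
      rw [zero_pow two_ne_zero, zero_add, ← Real.rpow_natCast, ← Real.rpow_mul (le_of_lt hx)]
      congr 1
      push_cast
      ring
    simp only [this]
  have hsP : ∀ s : ℝ, 0 < s → 0 < (s * Pt)⁻¹ := fun s hs => by positivity
  have hI0 : ∀ s : ℝ, 0 < s →
      IntegrableOn (fun x : ℝ => 1 / (1 + (s * Pt)⁻¹ * x ^ α)) (Ioi 0) ∧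
      CoxBipolar.laplace μ (N.typicalInterference Pt α) s =
        Real.exp (-2 * p * lamV * ∫ x in Ioi (0 : ℝ), 1 / (1 + (s * Pt)⁻¹ * x ^ α)) := by
    intro s hs
    refine ⟨(CoxBipolar.integrable_one_div_one_add_mul_rpow hα1 (hsP s hs) 0).integrableOn.congr_fun
      (hzero _) measurableSet_Ioi, ?_⟩
    rw [CoxBipolar.laplace_eq_toReal_lintegral (hN.measurable_typicalInterference Pt α) hfin0 hs.le,
      hN.lintegral_expNeg_typicalInterference hp1 hPt.le,
      CoxBipolar.expNeg_lineExponent_ofReal hlamV hp0 hα1 hPt hs,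
      ENNReal.toReal_ofReal (Real.exp_pos _).le,
      setIntegral_congr_fun measurableSet_Ioi (hzero _), hneg]
  have hI1 : ∀ s : ℝ, 0 < s →
      (∀ y : ℝ, IntegrableOn
        (fun x : ℝ => 1 / (1 + s⁻¹ * Pt⁻¹ * (y ^ 2 + x ^ 2) ^ (α / 2))) (Ioi 0)) ∧
      IntegrableOn (fun y : ℝ => 1 - Real.exp (-2 * p * lamV *
        ∫ x in Ioi (0 : ℝ), 1 / (1 + s⁻¹ * Pt⁻¹ * (y ^ 2 + x ^ 2) ^ (α / 2)))) (Ioi 0) ∧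
      CoxBipolar.laplace μ (N.otherInterference Pt α) s =
        Real.exp (-2 * Real.pi * lamL * ∫ y in Ioi (0 : ℝ), (1 - Real.exp (-2 * p * lamV *
          ∫ x in Ioi (0 : ℝ), 1 / (1 + s⁻¹ * Pt⁻¹ * (y ^ 2 + x ^ 2) ^ (α / 2))))) := by
    intro s hs
    simp only [hinv, hneg]
    refine ⟨fun y => (CoxBipolar.integrable_one_div_one_add_mul_rpow hα1 (hsP s hs) y).integrableOn,
      (CoxBipolar.integrable_one_sub_exp_setIntegral hα (hsP s hs) h2pl).integrableOn, ?_⟩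
    rw [CoxBipolar.laplace_eq_toReal_lintegral (hN.measurable_otherInterference Pt α) hfin1 hs.le,
      hN.lintegral_expNeg_otherInterference hp1 hPt.le,
      CoxBipolar.lintegral_one_sub_expNeg_lineExponent hlamV hp0 hα hPt hs,
      ← ENNReal.ofReal_mul (by positivity), ← ENNReal.ofReal_mul hlamL, CoxBipolar.expNeg_ofReal,
      ENNReal.toReal_ofReal (Real.exp_pos _).le]
    · congr 1
      ring
    · refine mul_nonneg hlamL (mul_nonneg (by positivity) (integral_nonneg fun y => ?_))
      have : 0 ≤ 2 * p * lamV *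
          ∫ x in Ioi (0 : ℝ), 1 / (1 + (s * Pt)⁻¹ * (y ^ 2 + x ^ 2) ^ (α / 2)) :=
        mul_nonneg h2pl (integral_nonneg fun x => by positivity)
      simpa using this
  set s₀ := β * d ^ α / Pt with hs₀
  have hs₀pos : 0 < s₀ := by positivity
  have hsucc : μ.real {ω | ENNReal.ofReal β < N.sinr Pt α d σ ω} =
      Real.exp (-(β * σ ^ 2 * d ^ α / Pt)) *
        CoxBipolar.laplace μ (N.typicalInterference Pt α) s₀ *
        CoxBipolar.laplace μ (N.otherInterference Pt α) s₀ := by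
    rw [measureReal_def, hN.measure_lt_sinr hPt hd hβ, ENNReal.toReal_mul, ENNReal.toReal_mul,
      ← CoxBipolar.laplace_eq_toReal_lintegral (hN.measurable_typicalInterference Pt α) hfin0
        hs₀pos.le,
      ← CoxBipolar.laplace_eq_toReal_lintegral (hN.measurable_otherInterference Pt α) hfin1
        hs₀pos.le,
      ← ENNReal.ofReal_mul hs₀pos.le, CoxBipolar.expNeg_ofReal (by positivity),
      ENNReal.toReal_ofReal (Real.exp_pos _).le, ← mul_assoc]
    congr 4
    rw [hs₀]
    ring
  have hsPt : s₀ * Pt = β * d ^ α := by rw [hs₀]; field_simp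
  have hb : 0 < β * d ^ α := by positivity
  have hfrac : ∀ u : ℝ, 0 < u → 1 / (1 + (s₀ * Pt)⁻¹ * u) =
      β * d ^ α * u⁻¹ / (1 + β * d ^ α * u⁻¹) := fun u hu => by
    rw [hsPt]
    field_simp
    ring
  have h0 : EqOn (fun x : ℝ => 1 / (1 + (s₀ * Pt)⁻¹ * x ^ α))
      (fun x => β * d ^ α * x ^ (-α) / (1 + β * d ^ α * x ^ (-α))) (Ioi 0) := fun x hx => by
    have hx' : 0 < x := hx
    simp only [Real.rpow_neg hx'.le]
    exact hfrac _ (by positivity)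
  have h1 : ∀ y : ℝ, EqOn (fun x : ℝ => 1 / (1 + s₀⁻¹ * Pt⁻¹ * (y ^ 2 + x ^ 2) ^ (α / 2)))
      (fun x => β * d ^ α * (y ^ 2 + x ^ 2) ^ (-α / 2) /
        (1 + β * d ^ α * (y ^ 2 + x ^ 2) ^ (-α / 2))) (Ioi 0) := fun y x hx => by
    have hx' : 0 < x := hx
    simp only [neg_div, hinv]
    rw [Real.rpow_neg (by positivity)]
    exact hfrac _ (by positivity)
  have h1int : ∀ y : ℝ, ∫ x in Ioi (0 : ℝ), β * d ^ α * (y ^ 2 + x ^ 2) ^ (-α / 2) /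
        (1 + β * d ^ α * (y ^ 2 + x ^ 2) ^ (-α / 2)) =
      ∫ x in Ioi (0 : ℝ), 1 / (1 + s₀⁻¹ * Pt⁻¹ * (y ^ 2 + x ^ 2) ^ (α / 2)) := fun y =>
    (setIntegral_congr_fun measurableSet_Ioi (h1 y)).symm
  obtain ⟨hint0, hL0⟩ := hI0 s₀ hs₀pos
  obtain ⟨hint1, hint2, hL1⟩ := hI1 s₀ hs₀pos
  refine ⟨hfin0.and hfin1, hI0, hI1, hsucc, hint0.congr_fun h0 measurableSet_Ioi,
    fun y => (hint1 y).congr_fun (h1 y) measurableSet_Ioi, ?_, ?_⟩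
  · simp only [h1int]
    exact hint2
  · rw [hsucc, hL0, hL1, ← Real.exp_add, ← Real.exp_add,
      setIntegral_congr_fun measurableSet_Ioi h0]
    simp only [h1int]
    congr 1
    ring
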